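/- Let $V=\bigcup_{n\ge 0}\mathbb{N}^n$ be the vertex set of the Ulam–Harris tree, where $\mathbb{N}=\{1,2,\dots\}$: the root is the empty word $\emptyset$, and the children of $v$ are the words $vi$, $i\in\mathbb{N}$. Given a random vector $\mathbf{X}=(X_i)_{i\in\mathbb{N}}$ with entries in $\mathbb{R}\cup\{+\infty\}$, which may be dependent, the branching random walk with displacement vector $\mathbf{X}$ consists of independent copies $\mathbf{X}^v=(X^v_i)_{i\in\mathbb{N}}$ of $\mathbf{X}$, one for each $v\in V$. The position of $v=v_1\cdots v_n$ is $S(v)=\sum_{i=1}^n X^{v_1\cdots v_{i-1}}_{v_i}$, the minimal position at generation $n$ is $M_n=\inf\{S(v):v\in\mathbb{N}^n\}$, and its median is $\mathrm{median}(M_n)=\sup\{x\in\mathbb{R}:\mathbb{P}(M_n<x)<1/2\}$. Say that $\mathbf{X}$ has exponential steps if, for each $i\ge 1$, $X_i$ is distributed as the sum of $i$ independent Exponential$(1)$ random variables. **Theorem.** There is an absolute constant $C$ such that for every branching random walk whose displacement vector has exponential steps and for every $n\ge 1$, the median of $M_n$ is finite and $$\left|\,\mathrm{median}(M_n)-\frac{n}{e}-\frac{3}{2e}\log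 n\,\right|\le C .$$ This class of walks includes the Poisson-weighted infinite tree, where $X_k=E_1+\dots+E_k$ with $E_1,E_2,\dots$ independent Exponential$(1)$ variables, and the Poisson–Dirichlet branching random walk, where $X_k=-\log\big((1-U_1)\cdots(1-U_{k-1})U_k\big)$ with $U_1,U_2,\dots$ independent and uniform on $[0,1]$: both displacement vectors have exponential steps. -/

import Mathlib

open MeasureTheory ProbabilityTheory

universe u

noncomputable section

namespace BRW

/-- The law on `ℝ` of the sum of `m` independent Exponential(1) random variables. -/
def sumExpLaw (m : ℕ) : Measure ℝ :=
  (Measure.pi fun _ : Fin m => expMeasure 1).map fun x => ∑ j, x j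

/-- `μ` is the joint law of a displacement vector `(X₁, X₂, …)` with values in `ℝ ∪ {+∞}`, where
`X_{i+1}` is the coordinate of index `i : ℕ`. It has exponential steps if each `X_{i+1}` is
distributed as a sum of `i + 1` independent Exponential(1) variables. Nothing is said about the
dependence between the coordinates. -/
def HasExponentialSteps (μ : Measure (ℕ → WithTop ℝ)) : Prop :=
  ∀ i : ℕ, μ.map (fun x => x i) = (sumExpLaw (i + 1)).map (fun t : ℝ => (t : WithTop ℝ))

/-- A branching random walk on the Ulam–Harris tree, whose vertices are the finite words over `ℕ`
(the root is the empty word, the children of `v` are the words `v ++ [i]`): the vertices carry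
independent displacement vectors `X v`, all with law `μ`. The entry `X v ω i` is the displacement
from `v` to its child `v ++ [i]`. -/
structure IsBranchingRandomWalk {Ω : Type*} [MeasurableSpace Ω] (P : Measure Ω)
    (μ : Measure (ℕ → WithTop ℝ)) (X : List ℕ → Ω → ℕ → WithTop ℝ) : Prop where
  hasLaw : ∀ v, HasLaw (X v) μ P
  indep : iIndepFun X P

/-- The position `S(v)` of the vertex `v = v₁ … v_n`: the sum of the displacements along the path
from the root to `v` (it is `+∞` as soon as one of them is). -/
def position {Ω : Type*} (X : List ℕ → Ω → ℕ → WithTop ℝ) (v : List ℕ) (ω : Ω) : WithTop ℝ :=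
  ∑ i : Fin v.length, X (v.take i) ω (v.get i)

/-- The inclusion of `ℝ ∪ {+∞}` in the extended reals. -/
def toEReal : WithTop ℝ → EReal
  | ⊤ => ⊤
  | (r : ℝ) => (r : EReal)

/-- The minimal position `M_n = inf {S(v) : v in generation n}`, in the extended reals. -/
def minPosition {Ω : Type*} (X : List ℕ → Ω → ℕ → WithTop ℝ) (n : ℕ) (ω : Ω) : EReal :=
  ⨅ v : {v : List ℕ // v.length = n}, toEReal (position X v.1 ω)

/-- The median `sup {x ∈ ℝ : P(M < x) < 1/2}`, the supremum being taken in the extended reals. -/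
def median {Ω : Type*} [MeasurableSpace Ω] (P : Measure Ω) (M : Ω → EReal) : EReal :=
  sSup ((fun x : ℝ => (x : EReal)) '' {x : ℝ | P {ω | M ω < (x : EReal)} < 1 / 2})

/-- The displacement vector `(E₁, E₁ + E₂, …)` of the Poisson-weighted infinite tree. -/
def pwitDisplacement {Ω : Type*} (E : ℕ → Ω → ℝ) (ω : Ω) (k : ℕ) : WithTop ℝ :=
  ((∑ j ∈ Finset.range (k + 1), E j ω : ℝ) : WithTop ℝ)

/-- The displacement vector `(-log G₁, -log G₂, …)` of the Poisson–Dirichlet branching random walk,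
where `G_k = (1 - U₁) ⋯ (1 - U_{k-1}) U_k`. -/
def pdDisplacement {Ω : Type*} (U : ℕ → Ω → ℝ) (ω : Ω) (k : ℕ) : WithTop ℝ :=
  ((-Real.log ((∏ j ∈ Finset.range k, (1 - U j ω)) * U k ω) : ℝ) : WithTop ℝ)

end BRW

end

/-! Write $u_n(x)=\mathbb{P}(M_n<x)$. The densities $t^ie^{-t}/i!$ of the displacements add up to
$1$ on $(0,\infty)$, so the mean number of children in a set is its Lebesgue measure, whatever the
dependence between siblings (`tsum_lintegral_sumExpLaw`). Splitting at the root, the union bound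
gives $u_{n+1}(x)\le\int_0^x u_n$ (`HasExponentialSteps.minProb_succ_le`), and a Bonferroni
inequality gives the reverse up to a quadratic error
(`HasExponentialSteps.integral_sub_sq_le_minProb`). The rest is analysis of these two relations.

Unconstrained, the linear recursion has the solution $x^n/n!$, of order $n^{-1/2}e^{ey}$ at
$x=n/e+y$. The constraint $u_n\le1$, or a linear barrier in the opposite direction, costs a further
factor $1/n$. Balancing $n^{-3/2}$ against $e^{ey}$ gives $y=\frac{3}{2e}\log n$.

Lower bound on the median: an explicit supersolution $A_n\,a(1-a/m_n)^{m_n-1}$, with $a$ the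
distance behind a front, dominates $u_n$. The front moves by $1+\frac{3}{2m_n}$ in units of $1/e$,
$m_n$ grows like $n$, and the amplitudes $A_n$ stay bounded because the relative error per step is
$O(m_n^{-3/2})$ (`profile_step`, `le_frontAmplitude_mul_profile`).

Upper bound: a subsolution of size $\varepsilon$ is killed above a line of slope $\alpha$ and paired
with Abel–Gontcharoff polynomials. Integration by parts makes the pairing monotone up to the
quadratic loss (`killedPairing_succ_ge`). With $(e\alpha)^n=n^{3/2}$ the main term is of order
$\varepsilon$ and the total loss $O(\varepsilon^2)$, so a small $\varepsilon$ gives $u_n(\alpha n)$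
bounded below (`exists_le_minProb_barrierSlope`). One more generation raises this to $1/2$
(`half_le_minProb_succ_of_le`). -/

namespace BRW

/-! ### The tree of displacements as a product space and its splitting at the root. -/

open Set Measure

/-- A realisation of all the displacement vectors. -/
abbrev DisplacementTree : Type := List ℕ → ℕ → WithTop ℝ

lemma toEReal_coe (t : ℝ) : toEReal (t : WithTop ℝ) = (t : EReal) := rfl

lemma toEReal_top : toEReal ⊤ = ⊤ := rfl

lemma toEReal_add (a b : WithTop ℝ) : toEReal (a + b) = toEReal a + toEReal b := by
  induction a using WithTop.recTopCoe with
  | top =>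
    induction b using WithTop.recTopCoe with
    | top => rfl
    | coe b => rw [WithTop.top_add, toEReal_top, toEReal_coe, EReal.top_add_coe]
  | coe a =>
    induction b using WithTop.recTopCoe with
    | top => rw [WithTop.add_top, toEReal_top, toEReal_coe, EReal.coe_add_top]
    | coe b => rw [← WithTop.coe_add, toEReal_coe, toEReal_coe, toEReal_coe, EReal.coe_add]

lemma toEReal_sum {ι : Type*} (s : Finset ι) (f : ι → WithTop ℝ) :
    toEReal (∑ i ∈ s, f i) = ∑ i ∈ s, toEReal (f i) := by
  classical
  induction s using Finset.induction_on with
  | empty => rfl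
  | insert a s ha ih => rw [Finset.sum_insert ha, Finset.sum_insert ha, toEReal_add, ih]

lemma measurable_toEReal : Measurable toEReal :=
  WithTop.measurable_of_measurable_comp_coe measurable_coe_real_ereal

lemma position_nil {Ω : Type*} (X : List ℕ → Ω → ℕ → WithTop ℝ) (ω : Ω) :
    position X [] ω = 0 := by
  simp [position]

lemma position_cons {Ω : Type*} (X : List ℕ → Ω → ℕ → WithTop ℝ) (i : ℕ) (v : List ℕ) (ω : Ω) :
    position X (i :: v) ω = X [] ω i + position (fun w => X (i :: w)) v ω := by
  unfold position
  exact Fin.sum_univ_succ (n := v.length)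
    (fun j : Fin (v.length + 1) => X ((i :: v).take j) ω ((i :: v).get j))

/-- The minimal position at generation `n` as a function of the displacement vectors. -/
noncomputable def treeMin (n : ℕ) (x : DisplacementTree) : EReal :=
  minPosition (fun v (x : DisplacementTree) => x v) n x

lemma measurable_treeMin (n : ℕ) : Measurable (treeMin n) := by
  unfold treeMin minPosition
  refine Measurable.iInf fun v => ?_
  unfold position
  simp only [toEReal_sum]
  refine Finset.measurable_sum _ fun i _ => measurable_toEReal.comp ?_
  exact (measurable_pi_apply _).comp (measurable_pi_apply _)

lemma treeMin_zero (x : DisplacementTree) : treeMin 0 x = 0 := by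
  unfold treeMin minPosition
  have h : ∀ v : {v : List ℕ // v.length = 0},
      toEReal (position (fun v (x : DisplacementTree) => x v) v.1 x) = 0 := by
    rintro ⟨v, hv⟩
    rw [List.length_eq_zero_iff] at hv
    subst hv
    rw [position_nil]; rfl
  have : Nonempty {v : List ℕ // v.length = 0} := ⟨⟨[], rfl⟩⟩
  simp only [h, iInf_const]

/-- With a strict inequality, an infimum over infinitely many vertices is below `c` exactly when
some vertex is, so no minimiser is needed. Infinite displacements drop out because `c` is real. -/
lemma treeMin_succ_lt_iff (n : ℕ) (x : DisplacementTree) (c : ℝ) :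
    treeMin (n + 1) x < (c : EReal) ↔
      ∃ i, ∃ t : ℝ, x [] i = (t : WithTop ℝ) ∧
        treeMin n (fun v => x (i :: v)) < ((c - t : ℝ) : EReal) := by
  have key : ∀ (t : ℝ) (b : WithTop ℝ),
      toEReal ((t : WithTop ℝ) + b) < (c : EReal) ↔ toEReal b < ((c - t : ℝ) : EReal) := by
    intro t b
    induction b using WithTop.recTopCoe with
    | top => simp [toEReal_top]
    | coe b =>
      rw [← WithTop.coe_add, toEReal_coe, toEReal_coe, EReal.coe_lt_coe_iff, EReal.coe_lt_coe_iff]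
      constructor <;> intro h <;> linarith
  unfold treeMin minPosition
  simp only [iInf_lt_iff]
  constructor
  · rintro ⟨⟨v, hv⟩, h⟩
    cases v with
    | nil => simp at hv
    | cons i v =>
      rw [position_cons] at h
      rcases hx : x [] i with _ | t
      · exfalso
        have : x [] i = ⊤ := hx
        rw [this, WithTop.top_add, toEReal_top] at h
        exact not_top_lt h
      · have hx' : x [] i = (t : WithTop ℝ) := hx
        refine ⟨i, t, hx', ⟨v, by simpa using hv⟩, ?_⟩
        rw [hx', key] at h
        exact h
  · rintro ⟨i, t, hx, ⟨v, hv⟩, h⟩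
    refine ⟨⟨i :: v, by simp [hv]⟩, ?_⟩
    rw [position_cons, hx, key]
    exact h

/-- The tree with root vector `y` and subtrees `z i`. -/
def joinTree (p : (ℕ → WithTop ℝ) × (ℕ → DisplacementTree)) : DisplacementTree
  | [] => p.1
  | i :: v => p.2 i v

lemma measurable_joinTree : Measurable joinTree := by
  refine measurable_pi_iff.2 fun v => ?_
  cases v with
  | nil => exact measurable_fst
  | cons i v => exact (measurable_pi_apply v).comp ((measurable_pi_apply i).comp measurable_snd)

/-- The joint law of independent displacement vectors with law `μ`. -/
noncomputable def treeLaw (μ : Measure (ℕ → WithTop ℝ)) : Measure DisplacementTree :=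
  infinitePi fun _ : List ℕ => μ

variable (μ : Measure (ℕ → WithTop ℝ)) [IsProbabilityMeasure μ]

instance : IsProbabilityMeasure (treeLaw μ) := by unfold treeLaw; infer_instance

/-- Currying: an independent sequence of trees is a single independent family indexed by pairs. -/
lemma infinitePi_treeLaw_pi (s : Finset (ℕ × List ℕ)) (t : ℕ × List ℕ → Set (ℕ → WithTop ℝ))
    (ht : ∀ p, MeasurableSet (t p)) :
    infinitePi (fun _ : ℕ => treeLaw μ) {z | ∀ p ∈ s, z p.1 p.2 ∈ t p} = ∏ p ∈ s, μ (t p) := by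
  have h := infinitePi_map_curry_symm (fun (_ : ℕ) (_ : List ℕ) => μ)
  rw [← infinitePi_pi (μ := fun _ : ℕ × List ℕ => μ) (s := s) (t := t) (fun p _ => ht p), ← h,
    map_apply (MeasurableEquiv.measurable _)
      (MeasurableSet.pi s.countable_toSet fun p _ => ht p)]
  rfl

/-- The branching property. Nonempty words correspond to pairs (first letter, remainder), so the
probability of a box factors into the root term and the terms of the subtrees; boxes determine the
product measure. -/
lemma map_joinTree :
    (μ.prod (infinitePi fun _ : ℕ => treeLaw μ)).map joinTree = treeLaw μ := by
  classical
  refine eq_infinitePi _ fun s t ht => ?_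
  rw [map_apply measurable_joinTree (MeasurableSet.pi s.countable_toSet fun v _ => ht v)]
  let f : ℕ × List ℕ → List ℕ := fun p => p.1 :: p.2
  have hf : Function.Injective f := by
    rintro ⟨a, b⟩ ⟨c, d⟩ h
    simpa [f] using h
  have hset : joinTree ⁻¹' ((s : Set (List ℕ)).pi t) =
      (if [] ∈ s then t [] else univ) ×ˢ
        {z | ∀ p ∈ s.preimage f hf.injOn, z p.1 p.2 ∈ t (f p)} := by
    ext ⟨y, z⟩
    simp only [mem_preimage, Set.mem_pi, Finset.mem_coe, mem_prod, mem_ofPred_eq,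
      Finset.mem_preimage]
    constructor
    · intro h
      refine ⟨?_, fun p hp => h _ hp⟩
      split_ifs with h0
      · exact h _ h0
      · trivial
    · rintro ⟨h1, h2⟩ v hv
      cases v with
      | nil => rw [if_pos hv] at h1; exact h1
      | cons i v => exact h2 (i, v) hv
  rw [hset, prod_prod, infinitePi_treeLaw_pi μ _ (fun p => t (f p)) (fun p => ht _)]
  have h1 : ∏ p ∈ s.preimage f hf.injOn, μ (t (f p)) = ∏ v ∈ s.filter (· ≠ []), μ (t v) := by
    rw [Finset.prod_preimage' f s hf.injOn (fun v => μ (t v))]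
    congr 1
    ext v
    simp only [Finset.mem_filter, mem_range, and_congr_right_iff]
    intro _
    cases v with
    | nil => simp [f]
    | cons i v => simp [f]
  rw [h1]
  by_cases h0 : [] ∈ s
  · rw [if_pos h0, Finset.filter_ne', Finset.mul_prod_erase s (fun v => μ (t v)) h0]
  · rw [if_neg h0, measure_univ, one_mul]
    congr 1
    refine Finset.filter_true_of_mem fun v hv h => h0 (h ▸ hv)

/-- The probability that the minimal position at generation `n` is less than `x`. -/
noncomputable def minProb (n : ℕ) (x : ℝ) : ℝ := (treeLaw μ).real {z | treeMin n z < (x : EReal)}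

end BRW

/-! ### Gamma laws and the unit-rate intensity of the children. -/

namespace BRW

open Set Measure
open scoped ENNReal

instance isProbabilityMeasure_expMeasure_one : IsProbabilityMeasure (expMeasure 1) :=
  isProbabilityMeasure_expMeasure one_pos

instance (m : ℕ) : IsProbabilityMeasure (sumExpLaw m) :=
  isProbabilityMeasure_map (by fun_prop)

lemma lintegral_expMeasure_one (f : ℝ → ℝ≥0∞) :
    ∫⁻ t, f t ∂expMeasure 1 = ∫⁻ t in Ioi 0, ENNReal.ofReal (Real.exp (-t)) * f t := by
  have h : expMeasure 1 = (volume : Measure ℝ).withDensity (exponentialPDF 1) := rfl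
  have h2 : (exponentialPDF 1) =
      (Ici (0 : ℝ)).indicator (fun t => ENNReal.ofReal (Real.exp (-t))) := by
    ext t
    rw [exponentialPDF_eq]
    by_cases ht : 0 ≤ t
    · simp [ht]
    · simp [ht]
  rw [h, h2, withDensity_indicator measurableSet_Ici,
    lintegral_withDensity_eq_lintegral_mul_non_measurable _ (by fun_prop)
      (by filter_upwards with t using ENNReal.ofReal_lt_top), setLIntegral_congr Ioi_ae_eq_Ici]
  rfl

lemma sumExpLaw_zero : sumExpLaw 0 = dirac 0 := by
  unfold sumExpLaw
  simp [Measure.map_const]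

lemma lintegral_sumExpLaw_succ (m : ℕ) {f : ℝ → ℝ≥0∞} (hf : Measurable f) :
    ∫⁻ t, f t ∂sumExpLaw (m + 1) = ∫⁻ s, ∫⁻ t, f (s + t) ∂sumExpLaw m ∂expMeasure 1 := by
  unfold sumExpLaw
  have hmp := measurePreserving_piFinSuccAbove (fun _ : Fin (m + 1) => expMeasure 1) 0
  rw [lintegral_map hf (by fun_prop)]
  have : ∀ x : Fin (m + 1) → ℝ, f (∑ j, x j) =
      (fun p : ℝ × (Fin m → ℝ) => f (p.1 + ∑ j, p.2 j))
        (MeasurableEquiv.piFinSuccAbove (fun _ => ℝ) 0 x) := by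
    intro x
    simp only [Fin.sum_univ_succ]
    rfl
  simp_rw [this]
  rw [hmp.lintegral_comp (f := fun p : ℝ × (Fin m → ℝ) => f (p.1 + ∑ j, p.2 j)) (by fun_prop),
    lintegral_prod _ (by fun_prop)]
  refine lintegral_congr fun s => ?_
  rw [lintegral_map (by fun_prop) (by fun_prop)]

/-- The Gamma density by convolution: the product of the exponentials depends only on the sum $u$,
and what remains is $\int_0^u t^m/m!\,dt=u^{m+1}/(m+1)!$. -/
lemma lintegral_sumExpLaw (m : ℕ) : ∀ {f : ℝ → ℝ≥0∞}, Measurable f →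
    ∫⁻ t, f t ∂sumExpLaw (m + 1) =
      ∫⁻ t in Ioi 0, ENNReal.ofReal (t ^ m / m.factorial * Real.exp (-t)) * f t := by
  induction m with
  | zero =>
    intro f hf
    rw [lintegral_sumExpLaw_succ 0 hf, lintegral_expMeasure_one]
    simp [sumExpLaw_zero]
  | succ m ih =>
    intro f hf
    rw [lintegral_sumExpLaw_succ _ hf]
    have h1 : ∀ s : ℝ, ∫⁻ t, f (s + t) ∂sumExpLaw (m + 1) =
        ∫⁻ t in Ioi 0, ENNReal.ofReal (t ^ m / m.factorial * Real.exp (-t)) * f (s + t) :=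
      fun s => ih (by fun_prop)
    simp_rw [h1]
    rw [lintegral_expMeasure_one]
    have h2 : ∀ s : ℝ, ENNReal.ofReal (Real.exp (-s)) *
        ∫⁻ t in Ioi 0, ENNReal.ofReal (t ^ m / m.factorial * Real.exp (-t)) * f (s + t) =
        ∫⁻ t in Ioi 0, ENNReal.ofReal (t ^ m / m.factorial) *
          (ENNReal.ofReal (Real.exp (-(s + t))) * f (s + t)) := by
      intro s
      rw [← lintegral_const_mul _ (by fun_prop)]
      refine setLIntegral_congr_fun measurableSet_Ioi fun t ht => ?_
      have ht' : (0 : ℝ) < t := ht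
      rw [← mul_assoc, ← mul_assoc, ← ENNReal.ofReal_mul (by positivity),
        ← ENNReal.ofReal_mul (by positivity), neg_add, Real.exp_add]
      congr 2
      ring
    simp_rw [h2]
    rw [lintegral_lintegral_swap (by fun_prop)]
    have h3 : ∀ t : ℝ, ∫⁻ s in Ioi (0 : ℝ), ENNReal.ofReal (t ^ m / m.factorial) *
          (ENNReal.ofReal (Real.exp (-(s + t))) * f (s + t)) =
        ∫⁻ u, ENNReal.ofReal (t ^ m / m.factorial) * (Ioi t).indicator
          (fun u => ENNReal.ofReal (Real.exp (-u)) * f u) u := by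
      intro t
      rw [lintegral_const_mul _ (by fun_prop), lintegral_const_mul _ (by
        exact Measurable.indicator (by fun_prop) measurableSet_Ioi),
        lintegral_indicator measurableSet_Ioi]
      congr 1
      rw [← lintegral_indicator measurableSet_Ioi, ← lintegral_indicator measurableSet_Ioi,
        ← lintegral_add_right_eq_self
          ((Ioi t).indicator fun u => ENNReal.ofReal (Real.exp (-u)) * f u) t]
      refine lintegral_congr fun s => ?_
      by_cases hs : 0 < s
      · simp [indicator, hs, add_comm]
      · simp [indicator, hs]
    simp_rw [h3]
    have hmeas : Measurable (Function.uncurry fun (t u : ℝ) =>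
        ENNReal.ofReal (t ^ m / m.factorial) * (Ioi t).indicator
          (fun u => ENNReal.ofReal (Real.exp (-u)) * f u) u) := by
      have : (Function.uncurry fun (t u : ℝ) =>
        ENNReal.ofReal (t ^ m / m.factorial) * (Ioi t).indicator
          (fun u => ENNReal.ofReal (Real.exp (-u)) * f u) u) =
          fun p : ℝ × ℝ => ENNReal.ofReal (p.1 ^ m / m.factorial) * {p : ℝ × ℝ | p.1 < p.2}.indicator
          (fun p => ENNReal.ofReal (Real.exp (-p.2)) * f p.2) p := by
        ext ⟨t, u⟩
        simp [indicator]
      rw [this]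
      exact Measurable.mul (by fun_prop) (Measurable.indicator (by fun_prop)
        (measurableSet_lt measurable_fst measurable_snd))
    rw [lintegral_lintegral_swap hmeas.aemeasurable, ← lintegral_indicator measurableSet_Ioi]
    refine lintegral_congr fun u => ?_
    have h4 : ∀ t : ℝ, ENNReal.ofReal (t ^ m / m.factorial) * (Ioi t).indicator
          (fun u => ENNReal.ofReal (Real.exp (-u)) * f u) u =
        (Iio u).indicator (fun t => ENNReal.ofReal (t ^ m / m.factorial)) t *
          (ENNReal.ofReal (Real.exp (-u)) * f u) := by
      intro t
      by_cases h : t < u <;> simp [indicator, h]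
    simp_rw [h4]
    rw [lintegral_mul_const _ (Measurable.indicator (by fun_prop) measurableSet_Iio),
      lintegral_indicator measurableSet_Iio, restrict_restrict measurableSet_Iio,
      Set.inter_comm, Ioi_inter_Iio]
    by_cases hu : 0 < u
    · rw [indicator_of_mem (show u ∈ Ioi 0 from hu), ← mul_assoc]
      congr 1
      rw [ENNReal.ofReal_mul (by positivity)]
      congr 1
      rw [setLIntegral_congr Ioo_ae_eq_Ioc, ← ofReal_integral_eq_lintegral_ofReal,
        ← intervalIntegral.integral_of_le hu.le, intervalIntegral.integral_div, integral_pow]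
      · congr 1
        rw [Nat.factorial_succ]
        push_cast
        field_simp
        simp
      · exact ((Continuous.div_const (by fun_prop) _).integrableOn_Icc).mono_set Ioc_subset_Icc_self
      · filter_upwards [ae_restrict_mem measurableSet_Ioc] with t ht
        have := ht.1.le
        simp only [Pi.zero_apply]
        positivity
    · rw [indicator_of_notMem (show u ∉ Ioi 0 from hu), Ioo_eq_empty hu]
      simp

/-- The weights $t^i e^{-t}/i!$ are Poisson probabilities and sum to one. Every first-moment
computation rests on this, and linearity makes the dependence between coordinates irrelevant. -/
lemma tsum_lintegral_sumExpLaw {f : ℝ → ℝ≥0∞} (hf : Measurable f) :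
    ∑' i : ℕ, ∫⁻ t, f t ∂sumExpLaw (i + 1) = ∫⁻ t in Ioi 0, f t := by
  simp_rw [fun i => lintegral_sumExpLaw i hf]
  rw [← lintegral_tsum fun i => by fun_prop]
  refine setLIntegral_congr_fun measurableSet_Ioi fun t ht => ?_
  have ht' : (0 : ℝ) < t := ht
  rw [ENNReal.tsum_mul_right]
  have h : HasSum (fun i : ℕ => t ^ i / i.factorial * Real.exp (-t)) 1 := by
    have := (NormedSpace.expSeries_div_hasSum_exp t).mul_right (Real.exp (-t))
    rwa [← Real.exp_eq_exp_ℝ, ← Real.exp_add, add_neg_cancel, Real.exp_zero] at this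
  rw [← ENNReal.ofReal_tsum_of_nonneg (fun i => by positivity) h.summable, h.tsum_eq]
  simp

lemma sum_sumExpLaw :
    Measure.sum (fun i : ℕ => sumExpLaw (i + 1)) = (volume : Measure ℝ).restrict (Ioi 0) := by
  ext s hs
  rw [Measure.sum_apply _ hs]
  have h := tsum_lintegral_sumExpLaw (f := s.indicator 1) (measurable_one.indicator hs)
  simpa [lintegral_indicator_one hs] using h

lemma lintegral_exp_neg_mul_expMeasure {c : ℝ} (hc : 0 ≤ c) :
    ∫⁻ t, ENNReal.ofReal (Real.exp (-(c * t))) ∂expMeasure 1 = ENNReal.ofReal (1 / (1 + c)) := by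
  rw [lintegral_expMeasure_one]
  have h : ∀ t : ℝ, ENNReal.ofReal (Real.exp (-t)) * ENNReal.ofReal (Real.exp (-(c * t))) =
      ENNReal.ofReal (Real.exp (-(1 + c) * t)) := by
    intro t
    rw [← ENNReal.ofReal_mul (by positivity), ← Real.exp_add]
    congr 2; ring
  simp_rw [h]
  have hneg : -(1 + c) < 0 := by linarith
  rw [← ofReal_integral_eq_lintegral_ofReal (integrableOn_exp_mul_Ioi hneg 0)
    (by filter_upwards with t using (Real.exp_pos _).le), integral_exp_mul_Ioi hneg]
  congr 1
  rw [mul_zero, Real.exp_zero, neg_div_neg_eq]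

/-- Used at $c=1$: the value $2^{-m}$ is the geometric decay that replaces independence of siblings
in the second-moment bound. -/
lemma lintegral_exp_neg_mul_sumExpLaw {c : ℝ} (hc : 0 ≤ c) (m : ℕ) :
    ∫⁻ t, ENNReal.ofReal (Real.exp (-(c * t))) ∂sumExpLaw m =
      ENNReal.ofReal ((1 / (1 + c)) ^ m) := by
  induction m with
  | zero => simp [sumExpLaw_zero]
  | succ m ih =>
    rw [lintegral_sumExpLaw_succ m (by fun_prop)]
    have h : ∀ s t : ℝ, ENNReal.ofReal (Real.exp (-(c * (s + t)))) =
        ENNReal.ofReal (Real.exp (-(c * s))) * ENNReal.ofReal (Real.exp (-(c * t))) := by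
      intro s t
      rw [← ENNReal.ofReal_mul (by positivity), ← Real.exp_add]
      congr 2; ring
    simp_rw [h]
    simp_rw [lintegral_const_mul _ (show Measurable fun t : ℝ =>
      ENNReal.ofReal (Real.exp (-(c * t))) by fun_prop)]
    rw [lintegral_mul_const _ (by fun_prop), ih, lintegral_exp_neg_mul_expMeasure hc,
      ← ENNReal.ofReal_mul (by positivity), pow_succ, mul_comm]

end BRW

/-! ### The integral inequality from above, by the union bound. -/

namespace BRW

open Set Measure
open scoped ENNReal

lemma IsBranchingRandomWalk.isProbabilityMeasure {Ω : Type*} [MeasurableSpace Ω] {P : Measure Ω}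
    [IsProbabilityMeasure P] {μ : Measure (ℕ → WithTop ℝ)} {X : List ℕ → Ω → ℕ → WithTop ℝ}
    (hX : IsBranchingRandomWalk P μ X) : IsProbabilityMeasure μ :=
  (hX.hasLaw []).isProbabilityMeasure_iff.1 inferInstance

lemma measurableSet_treeMin_lt (n : ℕ) (c : EReal) : MeasurableSet {z | treeMin n z < c} :=
  measurable_treeMin n measurableSet_Iio

lemma IsBranchingRandomWalk.measure_minPosition_lt {Ω : Type*} [MeasurableSpace Ω] {P : Measure Ω}
    [IsProbabilityMeasure P] {μ : Measure (ℕ → WithTop ℝ)} [IsProbabilityMeasure μ]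
    {X : List ℕ → Ω → ℕ → WithTop ℝ} (hX : IsBranchingRandomWalk P μ X) (n : ℕ) (c : EReal) :
    P {ω | minPosition X n ω < c} = treeLaw μ {z | treeMin n z < c} := by
  have hm : AEMeasurable (fun ω v => X v ω) P := aemeasurable_pi_iff.2 fun v =>
    (hX.hasLaw v).aemeasurable
  have h := hX.indep.hasLaw_infinitePi hX.hasLaw hm
  unfold treeLaw
  rw [← h.map_eq, map_apply_of_aemeasurable hm (measurableSet_treeMin_lt n c)]
  rfl

/-- The vertices with displacement `w` from the root whose subtrees reach below `x`. -/
def subtreeLT (n : ℕ) (x : ℝ) (w : WithTop ℝ) : Set DisplacementTree :=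
  {z | ∃ t : ℝ, w = (t : WithTop ℝ) ∧ treeMin n z < ((x - t : ℝ) : EReal)}

lemma subtreeLT_coe (n : ℕ) (x t : ℝ) :
    subtreeLT n x (t : WithTop ℝ) = {z | treeMin n z < ((x - t : ℝ) : EReal)} := by
  ext z
  simp only [subtreeLT, mem_ofPred_eq]
  constructor
  · rintro ⟨s, hs, h⟩
    rw [WithTop.coe_injective hs]; exact h
  · exact fun h => ⟨t, rfl, h⟩

lemma subtreeLT_top (n : ℕ) (x : ℝ) : subtreeLT n x ⊤ = ∅ := by
  ext z
  simp only [subtreeLT, mem_ofPred_eq, mem_empty_iff_false, iff_false, not_exists, not_and]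
  intro t ht
  exact absurd ht.symm (WithTop.coe_ne_top)

lemma measurableSet_subtreeLT (n : ℕ) (x : ℝ) (w : WithTop ℝ) :
    MeasurableSet (subtreeLT n x w) := by
  induction w using WithTop.recTopCoe with
  | top => rw [subtreeLT_top]; exact MeasurableSet.empty
  | coe t => rw [subtreeLT_coe]; exact measurableSet_treeMin_lt n _

variable (μ : Measure (ℕ → WithTop ℝ)) [IsProbabilityMeasure μ]

lemma minProb_mono (n : ℕ) : Monotone (minProb μ n) := fun x y hxy =>
  measureReal_mono fun _ hz => lt_of_lt_of_le hz (EReal.coe_le_coe_iff.2 hxy)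

omit [IsProbabilityMeasure μ] in
lemma minProb_nonneg (n : ℕ) (x : ℝ) : 0 ≤ minProb μ n x := measureReal_nonneg

lemma minProb_le_one (n : ℕ) (x : ℝ) : minProb μ n x ≤ 1 := measureReal_le_one

lemma measurable_minProb (n : ℕ) : Measurable (minProb μ n) := (minProb_mono μ n).measurable

lemma ofReal_minProb (n : ℕ) (x : ℝ) :
    ENNReal.ofReal (minProb μ n x) = treeLaw μ {z | treeMin n z < (x : EReal)} := by
  unfold minProb
  simp

lemma minProb_zero (x : ℝ) : minProb μ 0 x = if 0 < x then 1 else 0 := by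
  unfold minProb
  simp only [treeMin_zero]
  split_ifs with h
  · have : (0 : EReal) < x := by exact_mod_cast h
    simp [this]
  · have : ¬ (0 : EReal) < x := by exact_mod_cast h
    simp [this]

lemma measurable_treeLaw_subtreeLT (n : ℕ) (x : ℝ) :
    Measurable fun w => treeLaw μ (subtreeLT n x w) := by
  refine WithTop.measurable_of_measurable_comp_coe ?_
  have : ((fun w => treeLaw μ (subtreeLT n x w)) ∘ fun t : ℝ => (t : WithTop ℝ)) =
      fun t => ENNReal.ofReal (minProb μ n (x - t)) := by
    ext t
    simp only [Function.comp_apply, subtreeLT_coe, ofReal_minProb]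
  have h2 := measurable_minProb μ n
  change Measurable ((fun w => treeLaw μ (subtreeLT n x w)) ∘ fun t : ℝ => (t : WithTop ℝ))
  rw [this]
  fun_prop

lemma measurableSet_joinTree_lt (n : ℕ) (x : ℝ) :
    MeasurableSet (joinTree ⁻¹' {z | treeMin (n + 1) z < (x : EReal)}) :=
  measurable_joinTree (measurableSet_treeMin_lt _ _)

lemma joinTree_slice (n : ℕ) (x : ℝ) (y : ℕ → WithTop ℝ) :
    Prod.mk y ⁻¹' (joinTree ⁻¹' {z | treeMin (n + 1) z < (x : EReal)}) =
      ⋃ i, Function.eval i ⁻¹' subtreeLT n x (y i) := by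
  ext z
  simp only [mem_preimage, mem_ofPred_eq, treeMin_succ_lt_iff, mem_iUnion, subtreeLT,
    Function.eval]
  rfl

/-- Fubini over the root vector: given `y`, the event is a union of independent events, one per
child. -/
lemma ofReal_minProb_succ (n : ℕ) (x : ℝ) :
    ENNReal.ofReal (minProb μ (n + 1) x) =
      ∫⁻ y, infinitePi (fun _ : ℕ => treeLaw μ)
        (⋃ i, Function.eval i ⁻¹' subtreeLT n x (y i)) ∂μ := by
  have h : treeLaw μ {z | treeMin (n + 1) z < (x : EReal)} =
      (μ.prod (infinitePi fun _ : ℕ => treeLaw μ))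
        (joinTree ⁻¹' {z | treeMin (n + 1) z < (x : EReal)}) := by
    rw [← map_apply measurable_joinTree (measurableSet_treeMin_lt _ _), map_joinTree μ]
  rw [ofReal_minProb, h, prod_apply (measurableSet_joinTree_lt n x)]
  simp only [joinTree_slice]

lemma infinitePi_eval_preimage (i : ℕ) {s : Set DisplacementTree} (hs : MeasurableSet s) :
    infinitePi (fun _ : ℕ => treeLaw μ) (Function.eval i ⁻¹' s) = treeLaw μ s := by
  rw [← map_apply (measurable_pi_apply i) hs]
  congr 1
  exact infinitePi_map_eval (fun _ : ℕ => treeLaw μ) i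

variable {μ}

omit [IsProbabilityMeasure μ] in
lemma HasExponentialSteps.lintegral_comp (hμ : HasExponentialSteps μ) (i : ℕ)
    {f : WithTop ℝ → ℝ≥0∞} (hf : Measurable f) :
    ∫⁻ y, f (y i) ∂μ = ∫⁻ t : ℝ, f (t : WithTop ℝ) ∂sumExpLaw (i + 1) := by
  rw [← lintegral_map hf (measurable_pi_apply i), hμ i,
    lintegral_map hf WithTop.measurable_coe]

lemma HasExponentialSteps.ofReal_minProb_succ_le (hμ : HasExponentialSteps μ) (n : ℕ) (x : ℝ) :
    ENNReal.ofReal (minProb μ (n + 1) x) ≤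
      ∫⁻ t in Ioi (0 : ℝ), ENNReal.ofReal (minProb μ n (x - t)) := by
  have hm := measurable_minProb μ n
  calc ENNReal.ofReal (minProb μ (n + 1) x)
      ≤ ∫⁻ y, ∑' i, treeLaw μ (subtreeLT n x (y i)) ∂μ := by
        rw [ofReal_minProb_succ]
        refine lintegral_mono fun y => (measure_iUnion_le _).trans ?_
        exact ENNReal.tsum_le_tsum fun i =>
          (infinitePi_eval_preimage μ i (measurableSet_subtreeLT n x _)).le
    _ = ∑' i : ℕ, ∫⁻ t : ℝ, ENNReal.ofReal (minProb μ n (x - t)) ∂sumExpLaw (i + 1) := by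
        refine (lintegral_tsum (f := fun (i : ℕ) (y : ℕ → WithTop ℝ) =>
          treeLaw μ (subtreeLT n x (y i))) fun i => ((measurable_treeLaw_subtreeLT μ n x).comp
          (measurable_pi_apply i)).aemeasurable).trans (tsum_congr fun i => ?_)
        rw [hμ.lintegral_comp i (measurable_treeLaw_subtreeLT μ n x)]
        simp only [subtreeLT_coe, ofReal_minProb]
    _ = _ := tsum_lintegral_sumExpLaw (by fun_prop)

lemma HasExponentialSteps.minProb_of_nonpos (hμ : HasExponentialSteps μ) (n : ℕ) :
    ∀ {x : ℝ}, x ≤ 0 → minProb μ n x = 0 := by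
  induction n with
  | zero =>
    intro x hx
    rw [minProb_zero, if_neg hx.not_gt]
  | succ n ih =>
    intro x hx
    have h := hμ.ofReal_minProb_succ_le n x
    have h0 : ∫⁻ t in Ioi (0 : ℝ), ENNReal.ofReal (minProb μ n (x - t)) = 0 := by
      rw [setLIntegral_congr_fun (g := 0) measurableSet_Ioi]
      · simp
      · intro t ht
        have ht' : (0 : ℝ) < t := ht
        simp [ih (show x - t ≤ 0 by linarith)]
    rw [h0, nonpos_iff_eq_zero, ENNReal.ofReal_eq_zero] at h
    exact le_antisymm h (minProb_nonneg μ _ _)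

lemma intervalIntegrable_minProb (n : ℕ) (a b : ℝ) :
    IntervalIntegrable (minProb μ n) volume a b :=
  (minProb_mono μ n).intervalIntegrable

lemma HasExponentialSteps.minProb_succ_le (hμ : HasExponentialSteps μ) (n : ℕ) {x : ℝ}
    (hx : 0 ≤ x) : minProb μ (n + 1) x ≤ ∫ t in (0 : ℝ)..x, minProb μ n t := by
  have hm := measurable_minProb μ n
  have hnn : 0 ≤ ∫ t in (0 : ℝ)..x, minProb μ n t :=
    intervalIntegral.integral_nonneg hx fun t _ => minProb_nonneg μ n t
  rw [← ENNReal.ofReal_le_ofReal_iff hnn]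
  refine (hμ.ofReal_minProb_succ_le n x).trans (le_of_eq ?_)
  rw [intervalIntegral.integral_of_le hx, ofReal_integral_eq_lintegral_ofReal
    ((intervalIntegrable_minProb n 0 x).1) (by filter_upwards with t using minProb_nonneg μ n t)]
  rw [setLIntegral_congr Ioo_ae_eq_Ioc.symm, ← lintegral_indicator measurableSet_Ioi,
    ← lintegral_indicator measurableSet_Ioo, ← lintegral_sub_left_eq_self _ x]
  refine lintegral_congr fun s => ?_
  rcases le_or_gt s 0 with hs | hs
  · simp [indicator, hs.not_gt, hμ.minProb_of_nonpos n hs]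
  · by_cases h : s < x <;> simp [indicator, hs, h]

/-! ### The integral inequality from below, by a second-moment bound. -/

/-- Bonferroni's inequality for independent events, the sum over pairs being at most half the square
of the sum. The induction also carries the linear bound $1-\sum a_i\le\prod(1-a_i)$. -/
lemma sum_sub_sq_le_one_sub_prod {ι : Type*} (s : Finset ι) (a : ι → ℝ)
    (h0 : ∀ i ∈ s, 0 ≤ a i) (h1 : ∀ i ∈ s, a i ≤ 1) :
    ∑ i ∈ s, a i - (∑ i ∈ s, a i) ^ 2 / 2 ≤ 1 - ∏ i ∈ s, (1 - a i) := by
  classical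
  have key : ∀ s' ⊆ s, 1 - ∑ i ∈ s', a i ≤ ∏ i ∈ s', (1 - a i) ∧
      ∑ i ∈ s', a i - (∑ i ∈ s', a i) ^ 2 / 2 ≤ 1 - ∏ i ∈ s', (1 - a i) := by
    intro s'
    induction s' using Finset.induction_on with
    | empty => intro _; simp
    | insert j t hj ih =>
      intro hs
      have hjs : j ∈ s := hs (Finset.mem_insert_self j t)
      obtain ⟨ih1, ih2⟩ := ih fun i hi => hs (Finset.mem_insert_of_mem hi)
      have hS : 0 ≤ ∑ i ∈ t, a i :=
        Finset.sum_nonneg fun i hi => h0 i (hs (Finset.mem_insert_of_mem hi))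
      rw [Finset.sum_insert hj, Finset.prod_insert hj]
      have := h0 j hjs
      have := h1 j hjs
      constructor <;> nlinarith
  exact (key s subset_rfl).2

lemma ae_pos_sumExpLaw (m : ℕ) : ∀ᵐ t ∂sumExpLaw (m + 1), 0 < t := by
  rw [ae_iff]
  have hms : MeasurableSet {t : ℝ | ¬ 0 < t} :=
    (measurableSet_lt measurable_const measurable_id).compl
  have h := lintegral_sumExpLaw m (f := {t : ℝ | ¬ 0 < t}.indicator 1) (measurable_one.indicator hms)
  rw [lintegral_indicator_one hms] at h
  rw [h, setLIntegral_congr_fun (g := 0) measurableSet_Ioi]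
  · simp
  · intro t ht
    have ht' : (0 : ℝ) < t := ht
    simp [ht']

lemma integral_exp_neg_sumExpLaw (m : ℕ) :
    ∫ t, Real.exp (-t) ∂sumExpLaw m = (1 / 2) ^ m := by
  rw [integral_eq_lintegral_of_nonneg_ae (by filter_upwards with t using (Real.exp_pos _).le)
    (by fun_prop)]
  have h := lintegral_exp_neg_mul_sumExpLaw zero_le_one m
  simp only [one_mul] at h
  rw [h, ENNReal.toReal_ofReal (by positivity)]
  norm_num

lemma integrable_exp_neg_sumExpLaw (m : ℕ) :
    Integrable (fun t => Real.exp (-t)) (sumExpLaw m) := by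
  refine ⟨by fun_prop, ?_⟩
  rw [hasFiniteIntegral_iff_ofReal (by filter_upwards with t using (Real.exp_pos _).le)]
  have h := lintegral_exp_neg_mul_sumExpLaw zero_le_one m
  simp only [one_mul] at h
  rw [h]
  exact ENNReal.ofReal_lt_top

omit [IsProbabilityMeasure μ] in
lemma HasExponentialSteps.integral_comp (hμ : HasExponentialSteps μ) (i : ℕ)
    {f : WithTop ℝ → ℝ} (hf : Measurable f) :
    ∫ y, f (y i) ∂μ = ∫ t : ℝ, f (t : WithTop ℝ) ∂sumExpLaw (i + 1) := by
  rw [← integral_map (measurable_pi_apply i).aemeasurable hf.aestronglyMeasurable, hμ i,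
    integral_map WithTop.measurable_coe.aemeasurable hf.aestronglyMeasurable]

/-- Only the first `K` children are kept, and their success probabilities are replaced by a
minorant; conditionally on the root vector the failures are independent. -/
lemma integral_one_sub_prod_le_minProb (n K : ℕ) (x : ℝ) {f : WithTop ℝ → ℝ} (hf : Measurable f)
    (h0 : ∀ w, 0 ≤ f w) (hle : ∀ w, f w ≤ (treeLaw μ).real (subtreeLT n x w)) :
    ∫ y, (1 - ∏ i ∈ Finset.range K, (1 - f (y i))) ∂μ ≤ minProb μ (n + 1) x := by
  have h1 : ∀ w, f w ≤ 1 := fun w => (hle w).trans measureReal_le_one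
  have hprod0 : ∀ y : ℕ → WithTop ℝ, 0 ≤ ∏ i ∈ Finset.range K, (1 - f (y i)) := fun y =>
    Finset.prod_nonneg fun i _ => sub_nonneg.2 (h1 _)
  have hprod1 : ∀ y : ℕ → WithTop ℝ, ∏ i ∈ Finset.range K, (1 - f (y i)) ≤ 1 := fun y =>
    Finset.prod_le_one (fun i _ => sub_nonneg.2 (h1 _)) fun i _ => by linarith [h0 (y i)]
  have hmeas : Measurable fun y : ℕ → WithTop ℝ => 1 - ∏ i ∈ Finset.range K, (1 - f (y i)) := by
    fun_prop
  have hint : Integrable (fun y : ℕ → WithTop ℝ => 1 - ∏ i ∈ Finset.range K, (1 - f (y i))) μ :=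
    Integrable.of_bound hmeas.aestronglyMeasurable 1 (by
      filter_upwards with y
      rw [Real.norm_eq_abs, abs_le]
      constructor <;> linarith [hprod0 y, hprod1 y])
  rw [← ENNReal.ofReal_le_ofReal_iff (minProb_nonneg μ _ _), ofReal_minProb_succ,
    ofReal_integral_eq_lintegral_ofReal hint
      (by filter_upwards with y using sub_nonneg.2 (hprod1 y))]
  refine lintegral_mono fun y => ?_
  have hms : ∀ i, MeasurableSet (subtreeLT n x (y i)) := fun i => measurableSet_subtreeLT n x _
  have hpi : infinitePi (fun _ : ℕ => treeLaw μ)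
      (Set.pi (Finset.range K : Set ℕ) fun i => (subtreeLT n x (y i))ᶜ) =
      ENNReal.ofReal (∏ i ∈ Finset.range K, (1 - (treeLaw μ).real (subtreeLT n x (y i)))) := by
    rw [infinitePi_pi _ fun i _ => (hms i).compl, ENNReal.ofReal_prod_of_nonneg
      fun i _ => sub_nonneg.2 measureReal_le_one]
    refine Finset.prod_congr rfl fun i _ => ?_
    rw [← probReal_compl_eq_one_sub (hms i), ofReal_measureReal]
  have hmpi : MeasurableSet (Set.pi (Finset.range K : Set ℕ) fun i => (subtreeLT n x (y i))ᶜ) :=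
    MeasurableSet.pi (Finset.countable_toSet _) fun i _ => (hms i).compl
  have hsub : (Set.pi (Finset.range K : Set ℕ) fun i => (subtreeLT n x (y i))ᶜ)ᶜ ⊆
      ⋃ i, Function.eval i ⁻¹' subtreeLT n x (y i) := by
    intro z hz
    simp only [Set.mem_pi, mem_compl_iff, not_forall, not_not] at hz
    obtain ⟨i, _, hi⟩ := hz
    exact mem_iUnion.2 ⟨i, hi⟩
  refine le_trans ?_ (measure_mono hsub)
  rw [prob_compl_eq_one_sub hmpi, hpi, ENNReal.ofReal_sub _ (hprod0 y), ENNReal.ofReal_one]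
  refine tsub_le_tsub_left (ENNReal.ofReal_le_ofReal ?_) _
  exact Finset.prod_le_prod (fun i _ => sub_nonneg.2 measureReal_le_one)
    fun i _ => by linarith [hle (y i)]

/-- A function on `ℝ`, reflected at `x` and extended by `0` to `+∞`. -/
noncomputable def reflectTop (q : ℝ → ℝ) (x : ℝ) (w : WithTop ℝ) : ℝ :=
  if w = ⊤ then 0 else q (x - w.untopD 0)

lemma reflectTop_coe (q : ℝ → ℝ) (x t : ℝ) : reflectTop q x (t : WithTop ℝ) = q (x - t) := by
  simp [reflectTop]

lemma measurable_reflectTop {q : ℝ → ℝ} (hq : Measurable q) (x : ℝ) :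
    Measurable (reflectTop q x) := by
  refine WithTop.measurable_of_measurable_comp_coe ?_
  have : (fun t : ℝ => reflectTop q x (t : WithTop ℝ)) = fun t => q (x - t) := by
    ext t; exact reflectTop_coe q x t
  change Measurable (fun t : ℝ => reflectTop q x (t : WithTop ℝ))
  rw [this]
  fun_prop

lemma reflectTop_nonneg {q : ℝ → ℝ} (hq : ∀ t, 0 ≤ q t) (x : ℝ) (w : WithTop ℝ) :
    0 ≤ reflectTop q x w := by
  unfold reflectTop
  split_ifs
  · exact le_rfl
  · exact hq _

omit [IsProbabilityMeasure μ] in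
lemma reflectTop_le {q : ℝ → ℝ} {n : ℕ} (hq : ∀ t, q t ≤ minProb μ n t) (x : ℝ)
    (w : WithTop ℝ) : reflectTop q x w ≤ (treeLaw μ).real (subtreeLT n x w) := by
  induction w using WithTop.recTopCoe with
  | top => simp [reflectTop]
  | coe t => rw [reflectTop_coe, subtreeLT_coe]; exact hq _

lemma geom_sum_le_of_lt_one {r : ℝ} (h0 : 0 ≤ r) (h1 : r < 1) (K : ℕ) :
    ∑ i ∈ Finset.range K, r ^ i ≤ 1 / (1 - r) := by
  rw [one_div, ← tsum_geometric_of_lt_one h0 h1]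
  exact (summable_geometric_of_lt_one h0 h1).sum_le_tsum _ fun i _ => pow_nonneg h0 i

/-- Cauchy–Schwarz with weights $(3/4)^i$. Siblings may be arbitrarily correlated, so cross terms
must be traded for squares; the squares will have mean $O(2^{-i})$, and $\frac43\cdot\frac12<1$
keeps the sum finite. -/
lemma sq_sum_range_le (K : ℕ) (a : ℕ → ℝ) :
    (∑ i ∈ Finset.range K, a i) ^ 2 ≤
      4 * ∑ i ∈ Finset.range K, (4 / 3 : ℝ) ^ i * a i ^ 2 := by
  have h := Finset.sum_sq_le_sum_mul_sum_of_sq_le_mul (Finset.range K) (r := a)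
    (f := fun i => (3 / 4 : ℝ) ^ i) (g := fun i => (4 / 3 : ℝ) ^ i * a i ^ 2)
    (fun i _ => by positivity) (fun i _ => by positivity) (fun i _ => by
      rw [← mul_assoc, ← mul_pow]; norm_num)
  refine h.trans (mul_le_mul_of_nonneg_right ?_ (Finset.sum_nonneg fun i _ => by positivity))
  exact (geom_sum_le_of_lt_one (by norm_num) (by norm_num) K).trans (by norm_num)

/-- The decay assumption squares to $D^2e^{-t}$, whose mean under the law of child `i` is
$D^22^{-(i+1)}$. The weighted Cauchy–Schwarz bound then gives $6D^2$ for the second moment of the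
sum, and Bonferroni halves it. -/
lemma HasExponentialSteps.integral_sub_sq_le_minProb (hμ : HasExponentialSteps μ) (n : ℕ)
    {x D : ℝ} (hx : 0 ≤ x) {q : ℝ → ℝ} (hq : Measurable q) (h0 : ∀ t, 0 ≤ q t)
    (hle : ∀ t, q t ≤ minProb μ n t) (hD : ∀ t, 0 < t → q (x - t) ≤ D * Real.exp (-(t / 2))) :
    (∫ t in (0 : ℝ)..x, q t) - 3 * D ^ 2 ≤ minProb μ (n + 1) x := by
  have h1 : ∀ t, q t ≤ 1 := fun t => (hle t).trans (minProb_le_one μ n t)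
  set f := reflectTop q x with hf
  have hfm : Measurable f := measurable_reflectTop hq x
  have hf0 : ∀ w, 0 ≤ f w := reflectTop_nonneg h0 x
  have hfle := reflectTop_le hle x
  have hf1 : ∀ w, f w ≤ 1 := fun w => (hfle w).trans measureReal_le_one
  have hfint : ∀ i : ℕ, Integrable (fun y : ℕ → WithTop ℝ => f (y i)) μ := fun i =>
    Integrable.of_bound (Measurable.aestronglyMeasurable (by fun_prop)) 1 (by
      filter_upwards with y
      rw [Real.norm_eq_abs, abs_of_nonneg (hf0 _)]; exact hf1 _)
  have hfint2 : ∀ i : ℕ, Integrable (fun y : ℕ → WithTop ℝ => f (y i) ^ 2) μ := fun i =>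
    Integrable.of_bound (Measurable.aestronglyMeasurable (by fun_prop)) 1 (by
      filter_upwards with y
      rw [Real.norm_eq_abs, abs_of_nonneg (sq_nonneg _)]
      exact pow_le_one₀ (hf0 _) (hf1 _))
  have hqint : ∀ m, Integrable (fun t => q (x - t)) (sumExpLaw m) := fun m =>
    Integrable.of_bound (Measurable.aestronglyMeasurable (by fun_prop)) 1 (by
      filter_upwards with t
      rw [Real.norm_eq_abs, abs_of_nonneg (h0 _)]; exact h1 _)
  have hsq : ∀ i : ℕ, ∫ y, f (y i) ^ 2 ∂μ ≤ D ^ 2 * (1 / 2) ^ (i + 1) := by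
    intro i
    rw [hμ.integral_comp i (f := fun w => f w ^ 2) (by fun_prop), ← integral_exp_neg_sumExpLaw,
      ← integral_const_mul]
    refine integral_mono_of_nonneg (by filter_upwards with t using sq_nonneg _)
      ((integrable_exp_neg_sumExpLaw _).const_mul _) ?_
    filter_upwards [ae_pos_sumExpLaw i] with t ht
    simp only [hf, reflectTop_coe]
    calc q (x - t) ^ 2 ≤ (D * Real.exp (-(t / 2))) ^ 2 := pow_le_pow_left₀ (h0 _) (hD t ht) 2
      _ = D ^ 2 * Real.exp (-t) := by
        rw [mul_pow, ← Real.exp_nat_mul]; congr 2; push_cast; ring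
  have hK : ∀ K : ℕ, ∑ i ∈ Finset.range K, ∫ t, q (x - t) ∂sumExpLaw (i + 1) - 3 * D ^ 2 ≤
      minProb μ (n + 1) x := by
    intro K
    refine le_trans ?_ (integral_one_sub_prod_le_minProb n K x hfm hf0 hfle)
    have hsumint : Integrable (fun y : ℕ → WithTop ℝ => ∑ i ∈ Finset.range K, f (y i)) μ :=
      integrable_finsetSum _ fun i _ => hfint i
    have hbd : Integrable (fun y : ℕ → WithTop ℝ =>
        4 * ∑ i ∈ Finset.range K, (4 / 3 : ℝ) ^ i * f (y i) ^ 2) μ :=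
      (integrable_finsetSum _ fun i _ => (hfint2 i).const_mul _).const_mul _
    have hbdle : ∫ y, 4 * ∑ i ∈ Finset.range K, (4 / 3 : ℝ) ^ i * f (y i) ^ 2 ∂μ ≤ 6 * D ^ 2 := by
      rw [integral_const_mul, integral_finsetSum _ fun i _ => (hfint2 i).const_mul _]
      simp_rw [integral_const_mul]
      calc 4 * ∑ i ∈ Finset.range K, (4 / 3 : ℝ) ^ i * ∫ y, f (y i) ^ 2 ∂μ
          ≤ 4 * ∑ i ∈ Finset.range K, (4 / 3 : ℝ) ^ i * (D ^ 2 * (1 / 2) ^ (i + 1)) := by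
            gcongr with i _
            exact hsq i
        _ = 2 * D ^ 2 * ∑ i ∈ Finset.range K, (2 / 3 : ℝ) ^ i := by
            rw [Finset.mul_sum, Finset.mul_sum]
            refine Finset.sum_congr rfl fun i _ => ?_
            rw [show (2 / 3 : ℝ) = 4 / 3 * (1 / 2) by norm_num, mul_pow, pow_succ]
            ring
        _ ≤ 2 * D ^ 2 * 3 := by
            gcongr
            exact (geom_sum_le_of_lt_one (by norm_num) (by norm_num) K).trans (by norm_num)
        _ = 6 * D ^ 2 := by ring
    calc ∑ i ∈ Finset.range K, ∫ t, q (x - t) ∂sumExpLaw (i + 1) - 3 * D ^ 2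
        = ∫ y, ∑ i ∈ Finset.range K, f (y i) ∂μ - 6 * D ^ 2 / 2 := by
          rw [integral_finsetSum _ fun i _ => hfint i]
          congr 1
          · refine Finset.sum_congr rfl fun i _ => ?_
            rw [hμ.integral_comp i hfm]
            simp only [hf, reflectTop_coe]
          · ring
      _ ≤ ∫ y, ∑ i ∈ Finset.range K, f (y i) ∂μ -
            (∫ y, 4 * ∑ i ∈ Finset.range K, (4 / 3 : ℝ) ^ i * f (y i) ^ 2 ∂μ) / 2 := by
          linarith
      _ = ∫ y, (∑ i ∈ Finset.range K, f (y i) -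
            (4 * ∑ i ∈ Finset.range K, (4 / 3 : ℝ) ^ i * f (y i) ^ 2) / 2) ∂μ := by
          rw [integral_sub hsumint (hbd.div_const 2), integral_div]
      _ ≤ _ := by
          refine integral_mono (hsumint.sub (hbd.div_const 2)) ?_ fun y => ?_
          · refine Integrable.of_bound (Measurable.aestronglyMeasurable (by fun_prop)) 1 ?_
            filter_upwards with y
            have a1 : 0 ≤ ∏ i ∈ Finset.range K, (1 - f (y i)) :=
              Finset.prod_nonneg fun i _ => sub_nonneg.2 (hf1 _)
            have a2 : ∏ i ∈ Finset.range K, (1 - f (y i)) ≤ 1 :=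
              Finset.prod_le_one (fun i _ => sub_nonneg.2 (hf1 _))
                fun i _ => by linarith [hf0 (y i)]
            rw [Real.norm_eq_abs, abs_le]
            constructor <;> linarith
          · have b1 := sum_sub_sq_le_one_sub_prod (Finset.range K) (fun i => f (y i))
              (fun i _ => hf0 _) (fun i _ => hf1 _)
            have b2 := sq_sum_range_le K (fun i => f (y i))
            simp only
            linarith
  have hIoi : IntegrableOn (fun t => q (x - t)) (Ioi 0) := by
    have hexp : IntegrableOn (fun t : ℝ => D * Real.exp (-(1 / 2) * t)) (Ioi 0) :=
      (integrableOn_exp_mul_Ioi (by norm_num) 0).const_mul D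
    refine Integrable.mono' hexp (Measurable.aestronglyMeasurable (by fun_prop)) ?_
    filter_upwards [ae_restrict_mem measurableSet_Ioi] with t ht
    rw [Real.norm_eq_abs, abs_of_nonneg (h0 _)]
    refine (hD t ht).trans (le_of_eq ?_)
    congr 2; ring
  -- As `K` tends to infinity the linear terms recover Lebesgue measure, while the quadratic loss is
  -- uniform in `K`.
  have hsum : HasSum (fun i : ℕ => ∫ t, q (x - t) ∂sumExpLaw (i + 1))
      (∫ t in Ioi (0 : ℝ), q (x - t)) := by
    have := hasSum_integral_measure (μ := fun i : ℕ => sumExpLaw (i + 1))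
      (f := fun t => q (x - t)) (by rw [sum_sumExpLaw]; exact hIoi)
    rwa [sum_sumExpLaw] at this
  have hlim := le_of_tendsto' (hsum.tendsto_sum_nat.sub_const (3 * D ^ 2)) hK
  have hq0 : ∀ t ≤ 0, q t = 0 := fun t ht =>
    le_antisymm ((hle t).trans (hμ.minProb_of_nonpos n ht).le) (h0 t)
  have hIoc : ∫ t in Ioi (0 : ℝ), q (x - t) = ∫ t in Ioc 0 x, q (x - t) := by
    refine setIntegral_eq_of_subset_of_forall_sdiff_eq_zero measurableSet_Ioi
      Ioc_subset_Ioi_self fun t ht => hq0 _ ?_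
    have h2 : ¬ t ≤ x := fun h => ht.2 ⟨ht.1, h⟩
    linarith
  rw [hIoc, ← intervalIntegral.integral_of_le hx,
    intervalIntegral.integral_comp_sub_left (fun t => q t) x, sub_self, sub_zero] at hlim
  exact hlim

end BRW

/-! ### Raising a positive probability to one half in one generation. -/

namespace BRW

open Set Measure Filter
open scoped ENNReal Topology

lemma exists_sum_sumExpLaw_Ioi_le (K : ℕ) {δ : ℝ} (hδ : 0 < δ) :
    ∃ c : ℝ, ∑ i ∈ Finset.range K, (sumExpLaw (i + 1)).real (Ioi c) ≤ δ := by
  have h : Tendsto (fun c : ℝ => ∑ i ∈ Finset.range K, (sumExpLaw (i + 1)).real (Ioi c)) atTop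
      (𝓝 (∑ i ∈ Finset.range K, 0)) := by
    refine tendsto_finsetSum _ fun i _ => ?_
    have h1 := tendsto_measure_iInter_atTop (μ := sumExpLaw (i + 1)) (s := fun c : ℝ => Ioi c)
      (fun c => measurableSet_Ioi.nullMeasurableSet) (fun a b hab => Ioi_subset_Ioi hab)
      ⟨0, measure_ne_top _ _⟩
    have h2 : ⋂ c : ℝ, Ioi c = ∅ := by
      ext t
      simp only [mem_iInter, mem_Ioi, mem_empty_iff_false, iff_false, not_forall, not_lt]
      exact ⟨t, le_rfl⟩
    rw [h2, measure_empty] at h1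
    exact (ENNReal.tendsto_toReal_zero_iff fun c => measure_ne_top _ _).2 h1
  simp only [Finset.sum_const_zero] at h
  exact (h.eventually (eventually_le_nhds hδ)).exists

/-- Take `K` with $(1-\varepsilon)^K<1/4$, then `c` such that the first `K` children all lie within
`c` of the root with probability at least $3/4$. Their subtrees are independent trials, so success
has probability at least $\frac34\cdot\frac34>\frac12$. The constant depends on `ε` alone. -/
lemma half_le_minProb_succ_of_le {ε : ℝ} (hε : 0 < ε) (hε1 : ε ≤ 1) :
    ∃ c : ℝ, ∀ (μ : Measure (ℕ → WithTop ℝ)) [IsProbabilityMeasure μ], HasExponentialSteps μ →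
      ∀ (n : ℕ) (x : ℝ), ε ≤ minProb μ n x → 1 / 2 ≤ minProb μ (n + 1) (x + c) := by
  obtain ⟨K, hK⟩ := exists_pow_lt_of_lt_one (show (0 : ℝ) < 1 / 4 by norm_num)
    (show 1 - ε < 1 by linarith)
  obtain ⟨c, hc⟩ := exists_sum_sumExpLaw_Ioi_le K (show (0 : ℝ) < 1 / 4 by norm_num)
  refine ⟨c, fun μ _ hμ n x hx => ?_⟩
  set f : WithTop ℝ → ℝ := (Iic (c : WithTop ℝ)).indicator fun _ => ε with hf
  have hfm : Measurable f := measurable_const.indicator measurableSet_Iic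
  have hf0 : ∀ w, 0 ≤ f w := fun w => indicator_nonneg (fun _ _ => hε.le) w
  have hf1 : ∀ w, f w ≤ 1 := fun w => indicator_le' (fun _ _ => hε1) (fun _ _ => zero_le_one) w
  have hfle : ∀ w, f w ≤ (treeLaw μ).real (subtreeLT n (x + c) w) := by
    intro w
    by_cases hw : w ≤ (c : WithTop ℝ)
    · obtain ⟨t, rfl⟩ := WithTop.ne_top_iff_exists.1 (ne_top_of_le_ne_top WithTop.coe_ne_top hw)
      have ht : t ≤ c := WithTop.coe_le_coe.1 hw
      rw [hf, indicator_of_mem (show (t : WithTop ℝ) ∈ Iic (c : WithTop ℝ) from hw), subtreeLT_coe]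
      exact hx.trans (minProb_mono μ n (by linarith))
    · rw [hf, indicator_of_notMem (show w ∉ Iic (c : WithTop ℝ) from hw)]
      exact measureReal_nonneg
  refine le_trans ?_ (integral_one_sub_prod_le_minProb n K (x + c) hfm hf0 hfle)
  set A : Set (ℕ → WithTop ℝ) := ⋃ i ∈ Finset.range K, {y | y i ∈ Ioi (c : WithTop ℝ)} with hA
  have hAm : MeasurableSet A := by
    refine Finset.measurableSet_biUnion _ fun i _ => ?_
    exact measurable_pi_apply i measurableSet_Ioi
  have hAle : μ.real A ≤ 1 / 4 := by
    refine ((measureReal_biUnion_finset_le _ _).trans (le_of_eq ?_)).trans hc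
    refine Finset.sum_congr rfl fun i _ => ?_
    have h1 : μ {y | y i ∈ Ioi (c : WithTop ℝ)} = sumExpLaw (i + 1) (Ioi c) := by
      have h2 := hμ i
      have h3 := congrArg (fun ν => ν (Ioi (c : WithTop ℝ))) h2
      rw [map_apply (measurable_pi_apply i) measurableSet_Ioi,
        map_apply WithTop.measurable_coe measurableSet_Ioi] at h3
      refine Eq.trans h3 (congrArg _ ?_)
      ext t
      simp
    rw [measureReal_def, measureReal_def, h1]
  have hprod0 : ∀ y : ℕ → WithTop ℝ, 0 ≤ ∏ i ∈ Finset.range K, (1 - f (y i)) := fun y =>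
    Finset.prod_nonneg fun i _ => sub_nonneg.2 (hf1 _)
  have hprod1 : ∀ y : ℕ → WithTop ℝ, ∏ i ∈ Finset.range K, (1 - f (y i)) ≤ 1 := fun y =>
    Finset.prod_le_one (fun i _ => sub_nonneg.2 (hf1 _)) fun i _ => by linarith [hf0 (y i)]
  calc (1 / 2 : ℝ) ≤ 3 / 4 * (1 - μ.real A) := by linarith
    _ = ∫ y, Aᶜ.indicator (fun _ => (3 / 4 : ℝ)) y ∂μ := by
      rw [integral_indicator_const _ hAm.compl, probReal_compl_eq_one_sub hAm, smul_eq_mul,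
        mul_comm]
    _ ≤ _ := by
      refine integral_mono ((integrable_const _).indicator hAm.compl) ?_ fun y => ?_
      · refine Integrable.of_bound (Measurable.aestronglyMeasurable (by fun_prop)) 1 ?_
        filter_upwards with y
        rw [Real.norm_eq_abs, abs_le]
        constructor <;> linarith [hprod0 y, hprod1 y]
      · by_cases hy : y ∈ A
        · rw [indicator_of_notMem (by simpa using hy)]
          exact sub_nonneg.2 (hprod1 y)
        · rw [indicator_of_mem (show y ∈ Aᶜ from hy)]
          have h1 : ∀ i ∈ Finset.range K, 1 - f (y i) = 1 - ε := by
            intro i hi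
            have h2 : y i ∈ Iic (c : WithTop ℝ) := by
              by_contra h
              have h' : (c : WithTop ℝ) < y i := not_le.1 h
              exact hy (mem_biUnion hi h')
            rw [hf, indicator_of_mem h2]
          simp only
          rw [Finset.prod_congr rfl h1, Finset.prod_const, Finset.card_range]
          linarith

/-! ### The two examples: the Poisson-weighted infinite tree and the Poisson–Dirichlet walk. -/

lemma map_sum_range_eq_sumExpLaw {Ω : Type*} [MeasurableSpace Ω] {P : Measure Ω}
    [IsProbabilityMeasure P] {E : ℕ → Ω → ℝ} (hE : iIndepFun E P)
    (hlaw : ∀ i, HasLaw (E i) (expMeasure 1) P) (m : ℕ) :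
    P.map (fun ω => ∑ j ∈ Finset.range m, E j ω) = sumExpLaw m := by
  have h1 : iIndepFun (fun j : Fin m => E j) P := hE.precomp Fin.val_injective
  have hae : ∀ j : Fin m, AEMeasurable (E j) P := fun j => (hlaw j).aemeasurable
  have h2 := h1.map_fun_eq_pi_map hae
  unfold sumExpLaw
  have h3 : (fun j : Fin m => P.map (E j)) = fun _ => expMeasure 1 := by
    ext1 j; exact (hlaw j).map_eq
  rw [h3] at h2
  rw [← h2, AEMeasurable.map_map_of_aemeasurable (by fun_prop) (aemeasurable_pi_iff.2 hae)]
  congr 1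
  ext ω
  simp [Finset.sum_range]

lemma hasExponentialSteps_map {Ω : Type*} [MeasurableSpace Ω] {P : Measure Ω}
    {Y : ℕ → Ω → ℝ} (hY : ∀ k, P.map (Y k) = sumExpLaw (k + 1)) (hm : ∀ k, AEMeasurable (Y k) P) :
    HasExponentialSteps (P.map fun ω k => (Y k ω : WithTop ℝ)) := by
  intro i
  have hae : AEMeasurable (fun ω k => (Y k ω : WithTop ℝ)) P :=
    aemeasurable_pi_iff.2 fun k => WithTop.measurable_coe.comp_aemeasurable (hm k)
  rw [AEMeasurable.map_map_of_aemeasurable (measurable_pi_apply i).aemeasurable hae, ← hY i,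
    AEMeasurable.map_map_of_aemeasurable WithTop.measurable_coe.aemeasurable (hm i)]
  rfl

theorem hasExponentialSteps_pwit {Ω : Type*} [MeasurableSpace Ω] {P : Measure Ω}
    [IsProbabilityMeasure P] {E : ℕ → Ω → ℝ} (hE : iIndepFun E P)
    (hlaw : ∀ i, HasLaw (E i) (expMeasure 1) P) :
    HasExponentialSteps (P.map (pwitDisplacement E)) :=
  hasExponentialSteps_map (fun k => map_sum_range_eq_sumExpLaw hE hlaw (k + 1)) fun _ =>
    Finset.aemeasurable_fun_sum _ fun j _ => (hlaw j).aemeasurable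

lemma map_neg_log_uniform :
    ((volume : Measure ℝ).restrict (Icc 0 1)).map (fun u => -Real.log u) = expMeasure 1 := by
  ext s hs
  have hm : Measurable fun u : ℝ => -Real.log u := by fun_prop
  rw [map_apply hm hs, ← lintegral_indicator_one hs, lintegral_expMeasure_one,
    ← lintegral_indicator_one (hm hs), setLIntegral_congr Ioo_ae_eq_Icc.symm]
  have himg : (fun t : ℝ => Real.exp (-t)) '' Ioi 0 = Ioo 0 1 := by
    ext u
    simp only [mem_image, mem_Ioi, mem_Ioo]
    constructor
    · rintro ⟨t, ht, rfl⟩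
      exact ⟨Real.exp_pos _, by simpa using ht⟩
    · rintro ⟨h0, h1⟩
      exact ⟨-Real.log u, by linarith [Real.log_neg h0 h1], by rw [neg_neg, Real.exp_log h0]⟩
  rw [← himg, lintegral_image_eq_lintegral_abs_deriv_mul measurableSet_Ioi
    (f' := fun t => -Real.exp (-t))]
  · refine setLIntegral_congr_fun measurableSet_Ioi fun t _ => ?_
    simp only [abs_neg, abs_of_pos (Real.exp_pos _)]
    congr 1
    have : Real.exp (-t) ∈ (fun u => -Real.log u) ⁻¹' s ↔ t ∈ s := by simp
    by_cases h : t ∈ s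
    · rw [indicator_of_mem h, indicator_of_mem (this.2 h)]; rfl
    · rw [indicator_of_notMem h, indicator_of_notMem fun h' => h (this.1 h')]
  · intro t _
    have := ((hasDerivAt_id t).neg.exp).hasDerivWithinAt (s := Ioi 0)
    simpa using this
  · intro a _ b _ hab
    simpa using hab

lemma map_neg_log_one_sub_uniform :
    ((volume : Measure ℝ).restrict (Icc 0 1)).map (fun u => -Real.log (1 - u)) = expMeasure 1 := by
  have h := (measurePreserving_sub_left (volume : Measure ℝ) 1).restrict_preimage
    (s := Icc (0 : ℝ) 1) measurableSet_Icc
  have hpre : (fun u : ℝ => 1 - u) ⁻¹' Icc 0 1 = Icc 0 1 := by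
    ext u
    simp only [mem_preimage, mem_Icc]
    constructor <;> rintro ⟨_, _⟩ <;> constructor <;> linarith
  rw [hpre] at h
  rw [← map_neg_log_uniform]
  nth_rw 2 [← h.map_eq]
  rw [map_map (by fun_prop) h.measurable]
  rfl

/-- The logarithm turns the stick-breaking product into the sum of $-\log(1-U_j)$ for $j<k$ and of
$-\log U_k$, which are independent and exponential because $U$ and $1-U$ are both uniform. -/
theorem hasExponentialSteps_poissonDirichlet {Ω : Type*} [MeasurableSpace Ω] {P : Measure Ω}
    [IsProbabilityMeasure P] {U : ℕ → Ω → ℝ} (hU : iIndepFun U P)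
    (hlaw : ∀ i, HasLaw (U i) (volume.restrict (Icc (0 : ℝ) 1)) P) :
    HasExponentialSteps (P.map (pdDisplacement U)) := by
  refine hasExponentialSteps_map (fun k => ?_) fun k => ?_
  · let g : ℕ → ℝ → ℝ := fun j u => if j < k then -Real.log (1 - u) else -Real.log u
    have hgm : ∀ j, Measurable (g j) := by
      intro j
      by_cases hj : j < k
      · simp only [g, hj, if_true]; fun_prop
      · simp only [g, hj, if_false]; fun_prop
    have hV : iIndepFun (fun j => g j ∘ U j) P := hU.comp g hgm
    have hVlaw : ∀ j, HasLaw (g j ∘ U j) (expMeasure 1) P := by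
      intro j
      refine ⟨(hgm j).comp_aemeasurable (hlaw j).aemeasurable, ?_⟩
      rw [← AEMeasurable.map_map_of_aemeasurable (hgm j).aemeasurable (hlaw j).aemeasurable,
        (hlaw j).map_eq]
      by_cases hj : j < k
      · simp only [g, hj, if_true]; exact map_neg_log_one_sub_uniform
      · simp only [g, hj, if_false]; exact map_neg_log_uniform
    rw [← map_sum_range_eq_sumExpLaw hV hVlaw (k + 1)]
    refine Measure.map_congr ?_
    -- Since `Real.log 0 = 0`, the logarithm of a product splits only where no factor vanishes; the
    -- exceptional set is null.
    have hae : ∀ᵐ ω ∂P, ∀ j, U j ω ≠ 0 ∧ U j ω ≠ 1 := by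
      rw [ae_all_iff]
      intro j
      have h1 : ∀ᵐ u ∂(volume.restrict (Icc (0 : ℝ) 1)), u ≠ 0 ∧ u ≠ 1 := by
        refine ae_restrict_of_ae ?_
        exact (Measure.ae_ne volume 0).and (Measure.ae_ne volume 1)
      rw [← (hlaw j).map_eq] at h1
      exact ae_of_ae_map (hlaw j).aemeasurable h1
    filter_upwards [hae] with ω hω
    have hne : ∀ j, 1 - U j ω ≠ 0 := fun j => sub_ne_zero.2 (hω j).2.symm
    rw [Real.log_mul (Finset.prod_ne_zero_iff.2 fun j _ => hne j) (hω k).1,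
      Real.log_prod fun j _ => hne j, Finset.sum_range_succ, neg_add, ← Finset.sum_neg_distrib]
    congr 1
    · refine Finset.sum_congr rfl fun j hj => ?_
      simp [g, Finset.mem_range.1 hj]
    · simp [g]
  · have h1 : ∀ j, AEMeasurable (U j) P := fun j => (hlaw j).aemeasurable
    refine AEMeasurable.neg (Real.measurable_log.comp_aemeasurable (AEMeasurable.mul ?_ (h1 k)))
    exact Finset.aemeasurable_fun_prod _ fun j _ => (h1 j).const_sub 1

end BRW

/-! ### A travelling supersolution, giving the lower bound on the median. -/

namespace BRW

open Set Measure

/-- The second-order term must be kept: it supplies $1/2$ of the coefficient $3/2$. The difference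
of the two sides has a nonnegative derivative. -/
lemma log_one_add_le_sub {t : ℝ} (ht : 0 ≤ t) :
    Real.log (1 + t) ≤ t - t ^ 2 / (2 * (1 + t)) := by
  set g : ℝ → ℝ := fun t => t - t ^ 2 / (2 * (1 + t)) - Real.log (1 + t) with hg
  have hd : ∀ x : ℝ, 0 ≤ x → HasDerivAt g (x ^ 2 / (2 * (1 + x) ^ 2)) x := by
    intro x hx
    have h1 : (1 + x) ≠ 0 := by positivity
    have h2 : HasDerivAt (fun t : ℝ => 1 + t) 1 x := (hasDerivAt_id x).const_add 1
    have h3 := ((hasDerivAt_id x).sub (((hasDerivAt_id x).pow 2).div (h2.const_mul 2)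
      (by positivity))).sub (h2.log h1)
    refine HasDerivAt.congr_deriv (f := g) h3 ?_
    simp only [id, Pi.pow_apply]
    field_simp
    ring
  have hmono : MonotoneOn g (Ici 0) := by
    refine monotoneOn_of_deriv_nonneg (convex_Ici 0)
      (fun x hx => (hd x hx).continuousAt.continuousWithinAt) ?_ ?_
    · intro x hx
      rw [interior_Ici] at hx
      exact (hd x (le_of_lt hx)).differentiableAt.differentiableWithinAt
    · intro x hx
      rw [interior_Ici] at hx
      rw [(hd x (le_of_lt hx)).deriv]
      positivity
  have h := hmono (mem_Ici.2 le_rfl) (mem_Ici.2 ht) ht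
  have h0 : g 0 = 0 := by simp [hg]
  rw [h0, hg] at h
  simp only at h
  linarith

/-- The one-step comparison of two consecutive barrier profiles, in logarithmic form. -/
lemma log_profile_step {s v : ℝ} (hs : 3 ≤ s) (hv : 1 / s - 3 / 2 / s ^ 2 < v) :
    -1 - Real.log (1 + 1 / s ^ 2) + s ^ 2 * Real.log ((v - (1 / s - 3 / 2 / s ^ 2)) / s ^ 2) ≤
      7 / s ^ 3 + (s ^ 2 + 1 / s) * Real.log (v / (s ^ 2 + 1 + 1 / s)) := by
  have hs0 : 0 < s := by linarith
  set D := 1 / s with hD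
  set δ := 3 / 2 / s ^ 2 with hδ
  set m := s ^ 2 with hm
  set d := D - δ with hd
  set m' := m + 1 + D with hm'
  have hD0 : 0 < D := by positivity
  have hm0 : 0 < m := by positivity
  have hδ0 : 0 < δ := by positivity
  have hm'0 : 0 < m' := by positivity
  have hDδ : δ ≤ D / 2 := by
    rw [hδ, hD, div_div, div_div, div_le_div_iff₀ (by positivity) (by positivity)]
    nlinarith
  have hd0 : 0 < d := by rw [hd]; linarith
  have hv0 : 0 < v := hd0.trans hv
  -- Here `v` is the new distance to the far end of the profile and `v - d` the old one. The term
  -- `-d / v`, multiplied by `m`, is the gain from the extra widening `D`.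
  have e1 : Real.log ((v - d) / m) ≤ Real.log (v / m') + Real.log (m' / m) - d / v := by
    have h1 : (v - d) / m = v / m' * (m' / m) * (1 - d / v) := by field_simp
    have h2 : 0 < 1 - d / v := by rw [sub_pos, div_lt_one hv0]; exact hv
    rw [h1, Real.log_mul (by positivity) h2.ne', Real.log_mul (by positivity) (by positivity)]
    linarith [Real.log_le_sub_one_of_pos h2]
  -- The widening also raises the exponent by `D`, which is costly for small `v`. The bound on $\log
  -- y$ is applied to $y=md/(Dv)$ so that the cost is exactly the gain `m * (d / v)` plus bounded
  -- terms, uniformly in `v`.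
  have e2 : -(D * Real.log (v / m')) ≤
      D * (Real.log (D / d) + Real.log (m' / m)) + m * (d / v) - D := by
    have h1 : (v / m')⁻¹ = (D / d * (m' / m)) * (m * d / (D * v)) := by field_simp
    have h3 : 0 < m * d / (D * v) := by positivity
    have h2 : -Real.log (v / m') =
        Real.log (D / d) + Real.log (m' / m) + Real.log (m * d / (D * v)) := by
      rw [← Real.log_inv, h1, Real.log_mul (by positivity) h3.ne',
        Real.log_mul (by positivity) (by positivity)]
    have h4 := Real.log_le_sub_one_of_pos h3
    have h5 : D * (m * d / (D * v)) = m * (d / v) := by field_simp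
    calc -(D * Real.log (v / m')) = D * -Real.log (v / m') := by ring
      _ = D * (Real.log (D / d) + Real.log (m' / m) + Real.log (m * d / (D * v))) := by rw [h2]
      _ ≤ D * (Real.log (D / d) + Real.log (m' / m) + (m * d / (D * v) - 1)) := by gcongr
      _ = _ := by rw [← h5]; ring
  have e3 : Real.log (m' / m) ≤ Real.log (1 + 1 / m) + D / (m + 1) := by
    have h1 : m' / m = (1 + 1 / m) * (1 + D / (m + 1)) := by rw [hm']; field_simp
    have h2 : 0 < 1 + D / (m + 1) := by positivity
    rw [h1, Real.log_mul (by positivity) h2.ne']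
    linarith [Real.log_le_sub_one_of_pos h2]
  have e4 : Real.log (m' / m) ≤ (1 + D) / m := by
    have := Real.log_le_sub_one_of_pos (show 0 < m' / m by positivity)
    refine this.trans (le_of_eq ?_)
    rw [hm']; field_simp; ring
  have e5 : Real.log (D / d) ≤ δ / d := by
    have := Real.log_le_sub_one_of_pos (show 0 < D / d by positivity)
    refine this.trans (le_of_eq ?_)
    rw [hd] at hd0 ⊢
    field_simp
    ring
  -- The origin of $3/2$: $(m-1)\log(1+1/m)=1-\frac{3}{2m}+O(m^{-2})$, where $1/2$ comes from the
  -- expansion of the logarithm and $1$ from the factor $m/(m+1)$. This gain of `δ` pays for the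
  -- loss of `δ` in `e8`.
  have e6 : (m - 1) * Real.log (1 + 1 / m) ≤ 1 - δ + 1 / m ^ 2 := by
    have hm1 : 0 ≤ m - 1 := by rw [hm]; nlinarith
    refine (mul_le_mul_of_nonneg_left (log_one_add_le_sub (show 0 ≤ 1 / m by positivity))
      hm1).trans ?_
    have h1 : 1 - δ + 1 / m ^ 2 - (m - 1) * (1 / m - (1 / m) ^ 2 / (2 * (1 + 1 / m))) =
        1 / (m ^ 2 * (m + 1)) := by
      rw [hδ]
      field_simp
      ring
    have h2 : 0 ≤ 1 / (m ^ 2 * (m + 1)) := by positivity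
    linarith
  have e7 : m * (D / (m + 1)) ≤ D := by
    rw [← mul_div_assoc, div_le_iff₀ (by positivity)]
    nlinarith
  have e8 : D * (δ / d) ≤ δ + 9 / 2 / s ^ 3 := by
    have h1 : D * (δ / d) = δ + δ ^ 2 / d := by
      rw [hd] at hd0 ⊢
      field_simp
      ring
    have h2 : δ ^ 2 / d ≤ δ ^ 2 / (D / 2) := by
      gcongr
      rw [hd]; linarith
    have h3 : δ ^ 2 / (D / 2) = 9 / 2 / s ^ 3 := by
      rw [hδ, hD]; field_simp; ring
    linarith
  have e9 : D * ((1 + D) / m) ≤ 4 / 3 / s ^ 3 := by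
    have h1 : D ≤ 1 / 3 := by
      rw [hD]; exact one_div_le_one_div_of_le (by norm_num) hs
    calc D * ((1 + D) / m) ≤ D * ((1 + 1 / 3) / m) := by gcongr
      _ = 4 / 3 / s ^ 3 := by rw [hD, hm]; field_simp; norm_num
  have e10 : 1 / m ^ 2 ≤ 1 / 3 / s ^ 3 := by
    rw [hm, div_div, div_le_div_iff₀ (by positivity) (by positivity)]
    nlinarith [pow_pos hs0 3]
  have e11 : m * Real.log ((v - d) / m) ≤
      m * (Real.log (v / m') + Real.log (m' / m) - d / v) := by gcongr
  have e12 : m * Real.log (m' / m) ≤ m * (Real.log (1 + 1 / m) + D / (m + 1)) := by gcongr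
  have e13 : D * Real.log (m' / m) ≤ D * ((1 + D) / m) := by gcongr
  have e14 : D * Real.log (D / d) ≤ D * (δ / d) := by gcongr
  have e15 : 7 / s ^ 3 = 9 / 2 / s ^ 3 + 4 / 3 / s ^ 3 + 1 / 3 / s ^ 3 + 5 / 6 / s ^ 3 := by ring
  have e16 : 0 ≤ 5 / 6 / s ^ 3 := by positivity
  linarith

/-- The profile of the minimal position near its front: `a` is the distance to the front and `m` is
the square of its width. -/
noncomputable def profile (m a : ℝ) : ℝ := a * (1 - a / m) ^ (m - 1)

/-- The left side is the integrated profile of squared width $s^2$; the right side is the next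
profile after the front has advanced by $1+\frac{3}{2s^2}$. The error factor has exponent of order
$s^{-3}$, summable when $s^2$ grows linearly. -/
lemma profile_step {s a : ℝ} (hs : 3 ≤ s) (ha : 0 ≤ a) (ham : a ≤ s ^ 2) :
    (1 / Real.exp 1) * (s ^ 2 / (s ^ 2 + 1)) * (a + 1) * (1 - a / s ^ 2) ^ (s ^ 2) ≤
      Real.exp (7 / s ^ 3) * profile (s ^ 2 + 1 + 1 / s) (a + 1 + 3 / 2 / s ^ 2) := by
  have hs0 : 0 < s := by linarith
  have hδ : 0 < 3 / 2 / s ^ 2 := by positivity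
  have hd : 3 / 2 / s ^ 2 < 1 / s := by
    rw [div_div, div_lt_div_iff₀ (by positivity) hs0]
    nlinarith
  set v := s ^ 2 - a + (1 / s - 3 / 2 / s ^ 2) with hv
  have hv0 : 0 < v := by rw [hv]; linarith
  have hm' : 0 < s ^ 2 + 1 + 1 / s := by positivity
  have hbase : 1 - (a + 1 + 3 / 2 / s ^ 2) / (s ^ 2 + 1 + 1 / s) = v / (s ^ 2 + 1 + 1 / s) := by
    rw [hv, eq_div_iff hm'.ne', sub_mul, div_mul_cancel₀ _ hm'.ne']
    ring
  unfold profile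
  rw [hbase]
  have hR : 0 < (v / (s ^ 2 + 1 + 1 / s)) ^ (s ^ 2 + 1 + 1 / s - 1) :=
    Real.rpow_pos_of_pos (by positivity) _
  rcases eq_or_lt_of_le ham with h | h
  · have : 1 - a / s ^ 2 = 0 := by rw [h, div_self (by positivity), sub_self]
    rw [this, Real.zero_rpow (by positivity), mul_zero]
    positivity
  · have hx : 0 < 1 - a / s ^ 2 := by rw [sub_pos, div_lt_one (by positivity)]; exact h
    have key : (1 / Real.exp 1) * (s ^ 2 / (s ^ 2 + 1)) * (1 - a / s ^ 2) ^ (s ^ 2) ≤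
        Real.exp (7 / s ^ 3) * (v / (s ^ 2 + 1 + 1 / s)) ^ (s ^ 2 + 1 + 1 / s - 1) := by
      have h1 := log_profile_step (v := v) hs (by rw [hv]; linarith)
      have h2 : (v - (1 / s - 3 / 2 / s ^ 2)) / s ^ 2 = 1 - a / s ^ 2 := by
        rw [hv]; field_simp; ring
      rw [h2] at h1
      have h3 : s ^ 2 / (s ^ 2 + 1) = Real.exp (-Real.log (1 + 1 / s ^ 2)) := by
        rw [Real.exp_neg, Real.exp_log (by positivity)]
        field_simp
      rw [h3, one_div, ← Real.exp_neg, Real.rpow_def_of_pos hx, Real.rpow_def_of_pos (by positivity),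
        ← Real.exp_add, ← Real.exp_add, ← Real.exp_add, Real.exp_le_exp]
      have h4 : s ^ 2 + 1 + 1 / s - 1 = s ^ 2 + 1 / s := by ring
      rw [h4]
      linarith
    calc _ = (1 / Real.exp 1) * (s ^ 2 / (s ^ 2 + 1)) * (1 - a / s ^ 2) ^ (s ^ 2) * (a + 1) := by
          ring
      _ ≤ Real.exp (7 / s ^ 3) * (v / (s ^ 2 + 1 + 1 / s)) ^ (s ^ 2 + 1 + 1 / s - 1) *
            (a + 1 + 3 / 2 / s ^ 2) := by
          refine mul_le_mul key (by linarith) (by linarith) (by positivity)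
      _ = _ := by ring

/-- The exponent `m - 1` makes the profile explicitly integrable; the contribution of the endpoint
$0$ has a favourable sign and is dropped. -/
lemma integral_profile_le {m z x : ℝ} (hm : 1 < m) (hx : 0 ≤ x) (hz : 0 ≤ z) (hzm : z ≤ m) :
    ∫ t in (0 : ℝ)..x, profile m (z - Real.exp 1 * t) ≤
      (1 / Real.exp 1) * (m / (m + 1)) * (z - Real.exp 1 * x + 1) *
        (1 - (z - Real.exp 1 * x) / m) ^ m := by
  have hm0 : 0 < m := by linarith
  have he := Real.exp_pos 1
  set F : ℝ → ℝ := fun t => (1 / Real.exp 1) * (m / (m + 1)) * ((z - Real.exp 1 * t + 1) *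
        (1 - (z - Real.exp 1 * t) / m) ^ m) with hF
  have hpos : ∀ t : ℝ, 0 ≤ t → 0 ≤ 1 - (z - Real.exp 1 * t) / m := by
    intro t ht
    rw [sub_nonneg, div_le_one hm0]
    nlinarith
  have hder : ∀ t ∈ uIcc 0 x, HasDerivAt F (profile m (z - Real.exp 1 * t)) t := by
    intro t ht
    rw [uIcc_of_le hx] at ht
    have hy := hpos t ht.1
    have h1 : HasDerivAt (fun t : ℝ => z - Real.exp 1 * t) (-Real.exp 1) t := by
      simpa using ((hasDerivAt_id t).const_mul (Real.exp 1)).const_sub z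
    have h2 : HasDerivAt (fun t : ℝ => 1 - (z - Real.exp 1 * t) / m) (Real.exp 1 / m) t := by
      have := (h1.div_const m).const_sub 1
      refine this.congr_deriv ?_
      ring
    have h3 := ((h1.add_const 1).mul (h2.rpow_const (p := m) (Or.inr hm.le))).const_mul
      ((1 / Real.exp 1) * (m / (m + 1)))
    refine HasDerivAt.congr_deriv (f := F) h3 ?_
    unfold profile
    have h4 : (1 - (z - Real.exp 1 * t) / m) ^ m =
        (1 - (z - Real.exp 1 * t) / m) ^ (m - 1) * (1 - (z - Real.exp 1 * t) / m) := by
      rw [← Real.rpow_add_one' hy (by linarith)]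
      congr 1; ring
    rw [h4]
    field_simp
    ring
  have hcont : ContinuousOn (fun t => profile m (z - Real.exp 1 * t)) (uIcc 0 x) := by
    unfold profile
    refine ContinuousOn.mul (by fun_prop) (ContinuousOn.rpow_const (by fun_prop) fun t _ => ?_)
    exact Or.inr (by linarith)
  rw [intervalIntegral.integral_eq_sub_of_hasDerivAt hder hcont.intervalIntegrable]
  have h0 : 0 ≤ F 0 := by
    have := Real.rpow_nonneg (hpos 0 le_rfl) m
    rw [hF]
    simp only [mul_zero, sub_zero] at this ⊢
    positivity
  have h1 : F x = (1 / Real.exp 1) * (m / (m + 1)) * (z - Real.exp 1 * x + 1) *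
        (1 - (z - Real.exp 1 * x) / m) ^ m := by rw [hF]; ring
  linarith

/-- Normalisation: an amplitude of at least $e^{9/2}$ makes the supersolution exceed $1$ throughout
this window near the front. -/
lemma exp_neg_le_profile {m a : ℝ} (hm : 9 ≤ m) (ha : 1 ≤ a) (ha3 : a ≤ 3) :
    Real.exp (-(9 / 2)) ≤ profile m a := by
  have hm0 : 0 < m := by linarith
  have h1 : a / m ≤ 1 / 3 := by rw [div_le_div_iff₀ hm0 (by norm_num)]; linarith
  have hx : 0 < 1 - a / m := by linarith
  have h2 : -(9 / 2) ≤ Real.log (1 - a / m) * (m - 1) := by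
    have h3 := Real.one_sub_inv_le_log_of_pos hx
    have h4 : -(3 / 2 * (a / m)) ≤ 1 - (1 - a / m)⁻¹ := by
      have h5 : (1 - a / m)⁻¹ ≤ 1 + 3 / 2 * (a / m) := by
        rw [inv_le_iff_one_le_mul₀ hx]
        nlinarith [div_nonneg (by linarith : 0 ≤ a) hm0.le]
      linarith
    have h6 : -(3 / 2 * (a / m)) * (m - 1) ≤ Real.log (1 - a / m) * (m - 1) := by
      apply mul_le_mul_of_nonneg_right (h4.trans h3); linarith
    have h7 : 3 / 2 * (a / m) * (m - 1) ≤ 3 / 2 * a := by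
      have : a / m * m = a := div_mul_cancel₀ _ hm0.ne'
      have h8 : 0 ≤ a / m := div_nonneg (by linarith) hm0.le
      nlinarith
    nlinarith
  unfold profile
  rw [Real.rpow_def_of_pos hx]
  calc Real.exp (-(9 / 2)) ≤ Real.exp (Real.log (1 - a / m) * (m - 1)) := Real.exp_le_exp.2 h2
    _ ≤ a * Real.exp (Real.log (1 - a / m) * (m - 1)) :=
      le_mul_of_one_le_left (Real.exp_pos _).le ha

lemma profile_le_exp {m a : ℝ} (hm : 9 ≤ m) (ha : 0 ≤ a) (ham : a ≤ m) :
    profile m a ≤ 4 * Real.exp (-(a / 4)) := by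
  have hm0 : 0 < m := by linarith
  have hx : 0 ≤ 1 - a / m := by rw [sub_nonneg, div_le_one hm0]; exact ham
  have h1 : (1 - a / m) ^ (m - 1) ≤ Real.exp (-(a / 2)) := by
    calc (1 - a / m) ^ (m - 1) ≤ (Real.exp (-(a / m))) ^ (m - 1) :=
          Real.rpow_le_rpow hx (Real.one_sub_le_exp_neg _) (by linarith)
      _ = Real.exp (-(a / m) * (m - 1)) := by rw [← Real.exp_mul]
      _ ≤ Real.exp (-(a / 2)) := by
          rw [Real.exp_le_exp]
          have h2 : a / m * m = a := div_mul_cancel₀ _ hm0.ne'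
          have h3 : a / m ≤ a / 9 := div_le_div_of_nonneg_left ha (by norm_num) hm
          nlinarith
  have h4 : a ≤ 4 * Real.exp (a / 4) := by linarith [Real.add_one_le_exp (a / 4)]
  unfold profile
  calc a * (1 - a / m) ^ (m - 1) ≤ (4 * Real.exp (a / 4)) * Real.exp (-(a / 2)) :=
        mul_le_mul h4 h1 (Real.rpow_nonneg hx _) (by positivity)
    _ = 4 * Real.exp (-(a / 4)) := by rw [mul_assoc, ← Real.exp_add]; congr 2; ring

/-- The squared width of the front at generation `n`. -/
noncomputable def frontWidth : ℕ → ℝ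
  | 0 => 9
  | n + 1 => frontWidth n + 1 + 1 / √(frontWidth n)

/-- The location of the front at generation `n`, in units of `1 / e`. -/
noncomputable def front (n : ℕ) : ℝ := 1 + n + ∑ j ∈ Finset.range n, 3 / 2 / frontWidth j

/-- The amplitude of the profile at generation `n`. -/
noncomputable def frontAmplitude (n : ℕ) : ℝ :=
  Real.exp (9 / 2 + ∑ j ∈ Finset.range n, 7 / √(frontWidth j) ^ 3)

lemma add_nine_le_frontWidth (n : ℕ) : n + 9 ≤ frontWidth n := by
  induction n with
  | zero => simp [frontWidth]
  | succ n ih =>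
    have : 0 ≤ 1 / √(frontWidth n) := by positivity
    rw [frontWidth]
    push_cast
    linarith

lemma nine_le_frontWidth (n : ℕ) : 9 ≤ frontWidth n := by
  have := add_nine_le_frontWidth n
  have := n.cast_nonneg (α := ℝ)
  linarith

lemma three_le_sqrt_frontWidth (n : ℕ) : 3 ≤ √(frontWidth n) :=
  Real.le_sqrt_of_sq_le (by linarith [nine_le_frontWidth n])

lemma sq_sqrt_frontWidth (n : ℕ) : √(frontWidth n) ^ 2 = frontWidth n :=
  Real.sq_sqrt (by linarith [nine_le_frontWidth n])

lemma front_succ (n : ℕ) : front (n + 1) = front n + 1 + 3 / 2 / frontWidth n := by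
  unfold front
  rw [Finset.sum_range_succ]
  push_cast
  ring

/-- Keeps the base $1-a/m$ of the profile nonnegative for all $x\ge0$. -/
lemma front_le_frontWidth (n : ℕ) : front n ≤ frontWidth n := by
  induction n with
  | zero => simp [frontWidth, front]
  | succ n ih =>
    rw [front_succ, frontWidth]
    have hs := three_le_sqrt_frontWidth n
    have h : 3 / 2 / frontWidth n ≤ 1 / √(frontWidth n) := by
      rw [← sq_sqrt_frontWidth n, Real.sqrt_sq (by linarith), div_div,
        div_le_div_iff₀ (by positivity) (by positivity)]
      nlinarith
    linarith

lemma front_pos (n : ℕ) : 0 < front n := by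
  unfold front
  have : 0 ≤ ∑ j ∈ Finset.range n, 3 / 2 / frontWidth j :=
    Finset.sum_nonneg fun j _ => div_nonneg (by norm_num) (by linarith [nine_le_frontWidth j])
  positivity

/-- At distance between $1$ and $3$ from the front the bound $u\le1$ suffices. Beyond $3$ the
recursion applies: the front advances by at most $2$ per step, so every point of the integral is at
distance at least $1$ from the previous front. Using $u\le1$ near the front is what produces the
linear factor in the profile. -/
lemma le_frontAmplitude_mul_profile {u : ℕ → ℝ → ℝ} (h0 : ∀ n x, x ≤ 0 → u n x = 0)
    (h1 : ∀ n x, u n x ≤ 1) (hint : ∀ n a b, IntervalIntegrable (u n) volume a b)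
    (hrec : ∀ n x, 0 ≤ x → u (n + 1) x ≤ ∫ t in (0 : ℝ)..x, u n t) (n : ℕ) :
    ∀ x, 0 ≤ x → 1 ≤ front n - Real.exp 1 * x →
      u n x ≤ frontAmplitude n * profile (frontWidth n) (front n - Real.exp 1 * x) := by
  have he := Real.exp_pos 1
  induction n with
  | zero =>
    intro x hx ha
    have hx0 : x = 0 := by
      have : front 0 = 1 := by simp [front]
      rw [this] at ha
      nlinarith
    rw [hx0, h0 0 0 le_rfl]
    simp only [front, frontAmplitude, frontWidth, profile]
    norm_num
    positivity
  | succ n ih =>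
    intro x hx ha
    set s := √(frontWidth n) with hs
    have hs3 : 3 ≤ s := three_le_sqrt_frontWidth n
    have hs2 : frontWidth n = s ^ 2 := (sq_sqrt_frontWidth n).symm
    rcases le_or_gt (front (n + 1) - Real.exp 1 * x) 3 with h3 | h3
    · refine (h1 _ _).trans ?_
      have h4 := exp_neg_le_profile (nine_le_frontWidth (n + 1)) ha h3
      have h5 : Real.exp (9 / 2) ≤ frontAmplitude (n + 1) := by
        unfold frontAmplitude
        rw [Real.exp_le_exp]
        have : 0 ≤ ∑ j ∈ Finset.range (n + 1), 7 / √(frontWidth j) ^ 3 :=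
          Finset.sum_nonneg fun j _ => by positivity
        linarith
      calc (1 : ℝ) = Real.exp (9 / 2) * Real.exp (-(9 / 2)) := by
            rw [← Real.exp_add, add_neg_cancel, Real.exp_zero]
        _ ≤ _ := mul_le_mul h5 h4 (by positivity) (by unfold frontAmplitude; positivity)
    · have hδ : 3 / 2 / frontWidth n ≤ 1 := by
        rw [div_le_one (by linarith [nine_le_frontWidth n])]
        linarith [nine_le_frontWidth n]
      have hfs := front_succ n
      have hA : 0 < frontAmplitude n := Real.exp_pos _
      have hcont : ContinuousOn
          (fun t => frontAmplitude n * profile (frontWidth n) (front n - Real.exp 1 * t))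
          (uIcc 0 x) := by
        unfold profile
        refine ContinuousOn.const_mul (ContinuousOn.mul (by fun_prop)
          (ContinuousOn.rpow_const (by fun_prop) fun t _ => Or.inr ?_)) _
        linarith [nine_le_frontWidth n]
      calc u (n + 1) x ≤ ∫ t in (0 : ℝ)..x, u n t := hrec n x hx
        _ ≤ ∫ t in (0 : ℝ)..x,
              frontAmplitude n * profile (frontWidth n) (front n - Real.exp 1 * t) := by
            refine intervalIntegral.integral_mono_on hx (hint n 0 x) hcont.intervalIntegrable
              fun t ht => ih t ht.1 ?_
            have : Real.exp 1 * t ≤ Real.exp 1 * x := by gcongr; exact ht.2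
            linarith
        _ ≤ frontAmplitude n * ((1 / Real.exp 1) * (s ^ 2 / (s ^ 2 + 1)) *
              (front n - Real.exp 1 * x + 1) *
                (1 - (front n - Real.exp 1 * x) / s ^ 2) ^ (s ^ 2)) := by
            rw [intervalIntegral.integral_const_mul, ← hs2]
            gcongr
            exact integral_profile_le (by linarith [nine_le_frontWidth n]) hx (front_pos n).le
              (front_le_frontWidth n)
        _ ≤ frontAmplitude n * (Real.exp (7 / s ^ 3) *
              profile (s ^ 2 + 1 + 1 / s) (front n - Real.exp 1 * x + 1 + 3 / 2 / s ^ 2)) := by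
            refine mul_le_mul_of_nonneg_left (profile_step hs3 (by linarith) ?_) hA.le
            rw [← hs2]
            have := front_le_frontWidth n
            nlinarith
        _ = _ := by
            rw [← mul_assoc]
            congr 1
            · unfold frontAmplitude
              rw [← Real.exp_add, Finset.sum_range_succ, ← hs, add_assoc]
            · rw [frontWidth, ← hs, hs2, hfs, hs2]
              congr 1
              ring

lemma exists_sum_inv_sqrt_frontWidth_pow_le :
    ∃ S : ℝ, 0 ≤ S ∧ ∀ n, ∑ j ∈ Finset.range n, 1 / √(frontWidth j) ^ 3 ≤ S := by
  have hsum : Summable fun j : ℕ => 1 / ((j + 1 : ℕ) : ℝ) ^ (3 / 2 : ℝ) :=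
    (summable_nat_add_iff 1).2 (Real.summable_one_div_nat_rpow.2 (by norm_num))
  refine ⟨∑' j : ℕ, 1 / ((j + 1 : ℕ) : ℝ) ^ (3 / 2 : ℝ), tsum_nonneg fun j => by positivity,
    fun n => ?_⟩
  refine le_trans (Finset.sum_le_sum fun j _ => ?_)
    (hsum.sum_le_tsum (Finset.range n) fun j _ => by positivity)
  have h1 : ((j + 1 : ℕ) : ℝ) ≤ frontWidth j := by
    have := add_nine_le_frontWidth j
    push_cast
    linarith
  have h2 : √(frontWidth j) ^ 3 = frontWidth j ^ (3 / 2 : ℝ) := by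
    rw [Real.sqrt_eq_rpow, ← Real.rpow_natCast, ← Real.rpow_mul (by linarith [nine_le_frontWidth j])]
    norm_num
  rw [h2]
  gcongr

/-- Telescoping $\log m_{j+1}-\log m_j\le m_j^{-1}+m_j^{-3/2}$ bounds $\sum_{j<n} 1/m_j$ below by
$\log m_n-O(1)$, and $m_n\ge n$. -/
lemma exists_le_front : ∃ C : ℝ, ∀ n : ℕ, 1 ≤ n → n + 3 / 2 * Real.log n - C ≤ front n := by
  obtain ⟨S, hS0, hS⟩ := exists_sum_inv_sqrt_frontWidth_pow_le
  refine ⟨3 / 2 * (Real.log 9 + S), fun n hn => ?_⟩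
  have key : ∀ n, Real.log (frontWidth n) ≤ Real.log 9 +
      ∑ j ∈ Finset.range n, 1 / frontWidth j + ∑ j ∈ Finset.range n, 1 / √(frontWidth j) ^ 3 := by
    intro n
    induction n with
    | zero => simp [frontWidth]
    | succ n ih =>
      have hw := nine_le_frontWidth n
      have hw0 : 0 < frontWidth n := by linarith
      have hs := three_le_sqrt_frontWidth n
      have h1 : frontWidth (n + 1) =
          frontWidth n * (1 + 1 / frontWidth n + 1 / √(frontWidth n) ^ 3) := by
        have h2 : √(frontWidth n) ^ 3 = frontWidth n * √(frontWidth n) := by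
          rw [pow_succ, sq_sqrt_frontWidth]
        rw [frontWidth, h2]
        field_simp
      have h3 : 0 < 1 + 1 / frontWidth n + 1 / √(frontWidth n) ^ 3 := by positivity
      rw [h1, Real.log_mul hw0.ne' h3.ne', Finset.sum_range_succ, Finset.sum_range_succ]
      linarith [Real.log_le_sub_one_of_pos h3]
  have h1 := key n
  have h2 := hS n
  have hn0 : (0 : ℝ) < n := by exact_mod_cast hn
  have h3 : Real.log n ≤ Real.log (frontWidth n) :=
    Real.log_le_log hn0 (by linarith [add_nine_le_frontWidth n])
  unfold front
  have h4 : ∑ j ∈ Finset.range n, 3 / 2 / frontWidth j =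
      3 / 2 * ∑ j ∈ Finset.range n, 1 / frontWidth j := by
    rw [Finset.mul_sum]
    refine Finset.sum_congr rfl fun j _ => ?_
    ring
  rw [h4]
  linarith

theorem exists_lt_half_of_recursion : ∃ C : ℝ, ∀ u : ℕ → ℝ → ℝ, (∀ n x, x ≤ 0 → u n x = 0) →
    (∀ n x, u n x ≤ 1) → (∀ n, Monotone (u n)) →
    (∀ n x, 0 ≤ x → u (n + 1) x ≤ ∫ t in (0 : ℝ)..x, u n t) →
    ∀ n : ℕ, 1 ≤ n →
      u n (n / Real.exp 1 + 3 / (2 * Real.exp 1) * Real.log n - C) < 1 / 2 := by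
  obtain ⟨S, hS0, hS⟩ := exists_sum_inv_sqrt_frontWidth_pow_le
  obtain ⟨C, hC⟩ := exists_le_front
  have he := Real.exp_pos 1
  -- Chosen so that the amplitude bound $e^{9/2+7S}$ times the tail $4e^{-A/4}$ equals
  -- $4e^{-4}<1/2$.
  set A : ℝ := 4 * (9 / 2 + 7 * S + 4) with hA
  refine ⟨(C + A) / Real.exp 1, fun u h0 h1 hmono hrec n hn => ?_⟩
  set x := (front n - A) / Real.exp 1 with hx
  have hex : Real.exp 1 * x = front n - A := by rw [hx]; field_simp
  have hle : u n (n / Real.exp 1 + 3 / (2 * Real.exp 1) * Real.log n - (C + A) / Real.exp 1) ≤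
      u n x := by
    apply hmono
    rw [hx]
    have h2 : n / Real.exp 1 + 3 / (2 * Real.exp 1) * Real.log n - (C + A) / Real.exp 1 =
        (n + 3 / 2 * Real.log n - C - A) / Real.exp 1 := by field_simp; ring
    rw [h2]
    gcongr
    exact hC n hn
  refine lt_of_le_of_lt hle ?_
  rcases le_or_gt x 0 with hx0 | hx0
  · rw [h0 n x hx0]; norm_num
  · have hA0 : 1 ≤ A := by rw [hA]; linarith
    have h3 := le_frontAmplitude_mul_profile h0 h1 (fun n a b => (hmono n).intervalIntegrable) hrec
      n x hx0.le (by rw [hex]; linarith)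
    have h4 : front n - Real.exp 1 * x = A := by rw [hex]; ring
    rw [h4] at h3
    have h5 : A ≤ frontWidth n := by
      have := front_le_frontWidth n
      have := mul_pos he hx0
      linarith
    have h6 := profile_le_exp (nine_le_frontWidth n) (by linarith) h5
    have h7 : frontAmplitude n ≤ Real.exp (9 / 2 + 7 * S) := by
      unfold frontAmplitude
      rw [Real.exp_le_exp]
      have h8 : ∑ j ∈ Finset.range n, 7 / √(frontWidth j) ^ 3 =
          7 * ∑ j ∈ Finset.range n, 1 / √(frontWidth j) ^ 3 := by
        rw [Finset.mul_sum]
        refine Finset.sum_congr rfl fun j _ => ?_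
        ring
      rw [h8]
      linarith [hS n]
    calc u n x ≤ frontAmplitude n * profile (frontWidth n) A := h3
      _ ≤ frontAmplitude n * (4 * Real.exp (-(A / 4))) :=
          mul_le_mul_of_nonneg_left h6 (Real.exp_pos _).le
      _ ≤ Real.exp (9 / 2 + 7 * S) * (4 * Real.exp (-(A / 4))) :=
          mul_le_mul_of_nonneg_right h7 (by positivity)
      _ = 4 * Real.exp (-4) := by
          rw [mul_left_comm, ← Real.exp_add]
          congr 2
          rw [hA]; ring
      _ < 1 / 2 := by
          have h9 : (16 : ℝ) < Real.exp 4 := by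
            have h10 := Real.exp_one_gt_d9
            have h11 : Real.exp 4 = Real.exp 1 ^ 4 := by rw [← Real.exp_nat_mul]; norm_num
            rw [h11]
            calc (16 : ℝ) = 2 ^ 4 := by norm_num
              _ < Real.exp 1 ^ 4 := by gcongr; linarith
          rw [Real.exp_neg, ← div_eq_mul_inv, div_lt_div_iff₀ (Real.exp_pos _) (by norm_num)]
          linarith

end BRW

/-! ### A subsolution killed at a linear barrier, and its dual polynomials. -/

namespace BRW

open Set Measure

/-- The Abel–Gontcharoff polynomials of the barrier `i ↦ α i`. -/
noncomputable def abelPoly (α : ℝ) : ℕ → ℝ → ℝ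
  | 0, _ => 1
  | i + 1, r => (r - α * (i + 1)) * r ^ i / (i + 1).factorial

/-- A solution of `g_{k+1}' = g_k` that is positive below `α (k + 2)`. -/
noncomputable def barrierSolution (α : ℝ) (k : ℕ) (x : ℝ) : ℝ :=
  (α * (k + 2) - x) * (x + α) ^ (k + 2) / (k + 3).factorial

/-- A multiple of a bound for `barrierSolution` that also controls its values to the left. -/
noncomputable def barrierMajorant (α : ℝ) (k : ℕ) (x : ℝ) : ℝ :=
  6 / α ^ 3 * ((α * (k + 3) - x) * (x + α) ^ (k + 2) / (k + 3).factorial)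

/-- The subsolution of the recursion for the distribution function of the minimum, killed at the
barrier `α (k + 1)`. -/
noncomputable def killedSolution (α ε : ℝ) : ℕ → ℝ → ℝ
  | 0 => (Ioo 0 α).indicator fun _ => ε
  | k + 1 => (Ioo 0 (α * (k + 2))).indicator fun x =>
      max 0 ((∫ t in (0 : ℝ)..x, killedSolution α ε k t) - 108 * ε ^ 2 * barrierMajorant α k x ^ 2)

lemma hasDerivAt_abelPoly_succ (α : ℝ) (i : ℕ) (r : ℝ) :
    HasDerivAt (abelPoly α (i + 1)) (abelPoly α i r) r := by
  have h1 : HasDerivAt (fun r : ℝ => r - α * (i + 1)) 1 r := (hasDerivAt_id r).sub_const _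
  have h2 := (h1.mul ((hasDerivAt_id r).pow i)).div_const ((i + 1).factorial : ℝ)
  refine HasDerivAt.congr_deriv (f := abelPoly α (i + 1)) h2 ?_
  cases i with
  | zero => simp [abelPoly]
  | succ i =>
    simp only [abelPoly, id, Pi.pow_apply, Nat.factorial_succ, Nat.add_sub_cancel]
    push_cast
    field_simp
    ring

lemma continuous_abelPoly (α : ℝ) (i : ℕ) : Continuous (abelPoly α i) := by
  cases i with
  | zero => exact continuous_const
  | succ i => unfold abelPoly; fun_prop

lemma abelPoly_nonneg {α : ℝ} (hα : 0 < α) {i : ℕ} {r : ℝ} (hr : α * i ≤ r) :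
    0 ≤ abelPoly α i r := by
  cases i with
  | zero => exact zero_le_one
  | succ i =>
    have h0 : 0 ≤ r := le_trans (by positivity) hr
    push_cast at hr
    have : 0 ≤ r - α * (i + 1) := sub_nonneg.2 hr
    unfold abelPoly
    positivity

/-- This sign allows the boundary term of the integration by parts in `killedPairing_succ_ge` to be
discarded. -/
lemma abelPoly_succ_barrier_nonpos {α : ℝ} (hα : 0 < α) (i : ℕ) :
    abelPoly α (i + 1) (α * i) ≤ 0 := by
  unfold abelPoly
  have h1 : α * i - α * (i + 1) ≤ 0 := by linarith
  exact div_nonpos_of_nonpos_of_nonneg (mul_nonpos_of_nonpos_of_nonneg h1 (by positivity))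
    (by positivity)

lemma hasDerivAt_barrierSolution_succ (α : ℝ) (k : ℕ) (x : ℝ) :
    HasDerivAt (barrierSolution α (k + 1)) (barrierSolution α k x) x := by
  have h1 : HasDerivAt (fun x : ℝ => α * ((k + 1 : ℕ) + 2) - x) (-1) x :=
    (hasDerivAt_id x).const_sub _
  have h2 : HasDerivAt (fun x : ℝ => (x + α) ^ (k + 3)) ((k + 3 : ℕ) * (x + α) ^ (k + 2) * 1) x :=
    ((hasDerivAt_id x).add_const α).pow (k + 3)
  have h3 := (h1.mul h2).div_const ((k + 4).factorial : ℝ)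
  refine HasDerivAt.congr_deriv (f := barrierSolution α (k + 1)) h3 ?_
  unfold barrierSolution
  rw [Nat.factorial_succ (k + 3)]
  push_cast
  field_simp
  ring

lemma continuous_barrierSolution (α : ℝ) (k : ℕ) : Continuous (barrierSolution α k) := by
  unfold barrierSolution; fun_prop

lemma continuous_barrierMajorant (α : ℝ) (k : ℕ) : Continuous (barrierMajorant α k) := by
  unfold barrierMajorant; fun_prop

lemma barrierSolution_nonneg {α : ℝ} (hα : 0 < α) {k : ℕ} {x : ℝ} (hx : 0 ≤ x)
    (hxk : x ≤ α * (k + 2)) : 0 ≤ barrierSolution α k x := by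
  have : 0 ≤ α * (k + 2) - x := sub_nonneg.2 hxk
  unfold barrierSolution
  positivity

lemma barrierMajorant_nonneg {α : ℝ} (hα : 0 < α) {k : ℕ} {x : ℝ} (hx : 0 ≤ x)
    (hxk : x ≤ α * (k + 3)) : 0 ≤ barrierMajorant α k x := by
  have : 0 ≤ α * (k + 3) - x := sub_nonneg.2 hxk
  unfold barrierMajorant
  positivity

lemma killedSolution_nonneg {α ε : ℝ} (hε : 0 ≤ ε) (k : ℕ) (x : ℝ) :
    0 ≤ killedSolution α ε k x := by
  cases k with
  | zero => exact indicator_nonneg (fun _ _ => hε) x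
  | succ k => exact indicator_nonneg (fun _ _ => le_max_left _ _) x

lemma killedSolution_eq_zero {α ε : ℝ} {k : ℕ} {x : ℝ} (hx : x ∉ Ioo 0 (α * (k + 1))) :
    killedSolution α ε k x = 0 := by
  cases k with
  | zero =>
    rw [killedSolution, indicator_of_notMem]
    simpa using hx
  | succ k =>
    rw [killedSolution, indicator_of_notMem]
    push_cast at hx
    rwa [add_assoc, one_add_one_eq_two] at hx

/-- The three facts feed one another: the upper bound gives integrability, which makes the next
primitive continuous and the next function measurable. The upper bound is comparison with an exact
solution of the linear recursion that is still positive past the killing point; $6/\alpha^3$ makes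
it at least $1$ on $(0,\alpha)$ at generation $0$. -/
lemma killedSolution_aux {α ε : ℝ} (hα : 0 < α) (hε : 0 ≤ ε) (k : ℕ) :
    Measurable (killedSolution α ε k) ∧ (∀ a b, IntervalIntegrable (killedSolution α ε k) volume a b) ∧
      ∀ x, 0 ≤ x → x ≤ α * (k + 2) →
        killedSolution α ε k x ≤ ε * (6 / α ^ 3 * barrierSolution α k x) := by
  have hint : ∀ k, Measurable (killedSolution α ε k) →
      (∀ x, 0 ≤ x → x ≤ α * (k + 2) →
        killedSolution α ε k x ≤ ε * (6 / α ^ 3 * barrierSolution α k x)) →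
      ∀ a b, IntervalIntegrable (killedSolution α ε k) volume a b := by
    intro k hm hle a b
    obtain ⟨B, hB⟩ := isCompact_Icc.exists_bound_of_continuousOn (s := Icc 0 (α * (k + 2)))
      (f := fun x => ε * (6 / α ^ 3 * barrierSolution α k x))
      (by have := continuous_barrierSolution α k; fun_prop)
    have h0 : 0 ≤ B := (norm_nonneg _).trans (hB 0 ⟨le_rfl, by positivity⟩)
    refine (intervalIntegrable_const (c := B)).mono_fun hm.aestronglyMeasurable ?_
    filter_upwards with x
    rw [Real.norm_eq_abs, Real.norm_eq_abs, abs_of_nonneg (killedSolution_nonneg hε k x),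
      abs_of_nonneg h0]
    by_cases hx : x ∈ Ioo 0 (α * (k + 1))
    · have hx2 : x ≤ α * (k + 2) := hx.2.le.trans (by gcongr; norm_num)
      exact (hle x hx.1.le hx2).trans ((le_abs_self _).trans (hB x ⟨hx.1.le, hx2⟩))
    · rw [killedSolution_eq_zero hx]; exact h0
  induction k with
  | zero =>
    have hm : Measurable (killedSolution α ε 0) := measurable_const.indicator measurableSet_Ioo
    have hle : ∀ x, 0 ≤ x → x ≤ α * ((0 : ℕ) + 2) →
        killedSolution α ε 0 x ≤ ε * (6 / α ^ 3 * barrierSolution α 0 x) := by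
      intro x hx hx2
      by_cases hxa : x ∈ Ioo 0 α
      · rw [killedSolution, indicator_of_mem hxa]
        refine le_mul_of_one_le_right hε ?_
        have h1 : α * α ^ 2 ≤ (α * 2 - x) * (x + α) ^ 2 := by
          refine mul_le_mul (by linarith [hxa.2]) (by gcongr; linarith) (by positivity)
            (by linarith [hxa.2])
        have h2 : 6 / α ^ 3 * barrierSolution α 0 x = (α * 2 - x) * (x + α) ^ 2 / α ^ 3 := by
          unfold barrierSolution
          simp [Nat.factorial]
        rw [h2, one_le_div (by positivity)]
        calc α ^ 3 = α * α ^ 2 := by ring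
          _ ≤ _ := h1
      · rw [killedSolution, indicator_of_notMem hxa]
        have := barrierSolution_nonneg hα hx hx2
        positivity
    exact ⟨hm, hint 0 hm hle, hle⟩
  | succ k ih =>
    obtain ⟨ihm, ihint, ihle⟩ := ih
    have hcont : Continuous fun x => ∫ t in (0 : ℝ)..x, killedSolution α ε k t :=
      intervalIntegral.continuous_primitive ihint 0
    have hm : Measurable (killedSolution α ε (k + 1)) := by
      have := (continuous_barrierMajorant α k).measurable
      have := hcont.measurable
      exact Measurable.indicator (by fun_prop) measurableSet_Ioo
    have hle : ∀ x, 0 ≤ x → x ≤ α * ((k + 1 : ℕ) + 2) →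
        killedSolution α ε (k + 1) x ≤ ε * (6 / α ^ 3 * barrierSolution α (k + 1) x) := by
      intro x hx hx2
      have hnn : 0 ≤ ε * (6 / α ^ 3 * barrierSolution α (k + 1) x) := by
        have := barrierSolution_nonneg hα hx hx2
        positivity
      by_cases hxa : x ∈ Ioo 0 (α * (k + 2))
      · rw [killedSolution, indicator_of_mem hxa]
        refine max_le hnn ?_
        have h1 : ∫ t in (0 : ℝ)..x, killedSolution α ε k t ≤
            ∫ t in (0 : ℝ)..x, ε * (6 / α ^ 3 * barrierSolution α k t) := by
          refine intervalIntegral.integral_mono_on hx (ihint 0 x) ?_ fun t ht =>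
            ihle t ht.1 (ht.2.trans hxa.2.le)
          have := continuous_barrierSolution α k
          exact Continuous.intervalIntegrable (by fun_prop) _ _
        have h2 : ∫ t in (0 : ℝ)..x, barrierSolution α k t =
            barrierSolution α (k + 1) x - barrierSolution α (k + 1) 0 :=
          intervalIntegral.integral_eq_sub_of_hasDerivAt
            (fun t _ => hasDerivAt_barrierSolution_succ α k t)
            ((continuous_barrierSolution α k).intervalIntegrable _ _)
        rw [intervalIntegral.integral_const_mul, intervalIntegral.integral_const_mul, h2] at h1
        have h3 : 0 ≤ barrierSolution α (k + 1) 0 :=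
          barrierSolution_nonneg hα le_rfl (by positivity)
        have h4 : 0 ≤ 108 * ε ^ 2 * barrierMajorant α k x ^ 2 := by positivity
        have h5 : ε * (6 / α ^ 3 * (barrierSolution α (k + 1) x - barrierSolution α (k + 1) 0)) ≤
            ε * (6 / α ^ 3 * barrierSolution α (k + 1) x) := by
          gcongr; linarith
        linarith
      · rw [killedSolution, indicator_of_notMem hxa]
        exact hnn
    exact ⟨hm, hint (k + 1) hm hle, hle⟩

lemma measurable_killedSolution {α ε : ℝ} (hα : 0 < α) (hε : 0 ≤ ε) (k : ℕ) :
    Measurable (killedSolution α ε k) := (killedSolution_aux hα hε k).1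

lemma intervalIntegrable_killedSolution {α ε : ℝ} (hα : 0 < α) (hε : 0 ≤ ε) (k : ℕ) (a b : ℝ) :
    IntervalIntegrable (killedSolution α ε k) volume a b := (killedSolution_aux hα hε k).2.1 a b

lemma killedSolution_le {α ε : ℝ} (hα : 0 < α) (hε : 0 ≤ ε) {k : ℕ} {x : ℝ} (hx : 0 ≤ x)
    (hxk : x ≤ α * (k + 2)) :
    killedSolution α ε k x ≤ ε * (6 / α ^ 3 * barrierSolution α k x) :=
  (killedSolution_aux hα hε k).2.2 x hx hxk

/-- Supplies the decay required by the second-moment bound. Moving left by `t`, the linear factor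
grows by at most $1+t/\alpha\le6e^{t/(6\alpha)}$, since $\alpha(k+3)-x\ge\alpha$, while the power
loses $e^{-2t/(3\alpha)}$; and $\frac23-\frac16=\frac12$. -/
lemma barrierSolution_sub_le {α : ℝ} (hα : 0 < α) (hα1 : α ≤ 1) {k : ℕ} {x t : ℝ} (ht : 0 < t)
    (hxt : 0 ≤ x - t) (hxk : x ≤ α * (k + 2)) :
    6 / α ^ 3 * barrierSolution α k (x - t) ≤ 6 * barrierMajorant α k x * Real.exp (-(t / 2)) := by
  have hx : 0 < x := by linarith
  have hxa : 0 < x + α := by linarith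
  have h1 : α * (k + 2) - (x - t) ≤ (α * (k + 3) - x) * (1 + t / α) := by
    have h2 : t ≤ (α * (k + 3) - x) * (t / α) := by
      calc t = α * (t / α) := by field_simp
        _ ≤ _ := by gcongr; linarith
    linarith
  have h3 : (x - t + α) ^ (k + 2) ≤ (x + α) ^ (k + 2) * Real.exp (-(2 / 3 * (t / α))) := by
    have h4 : x - t + α = (x + α) * (1 - t / (x + α)) := by field_simp; ring
    have h5 : 0 ≤ 1 - t / (x + α) := by
      rw [sub_nonneg, div_le_one hxa]; linarith
    rw [h4, mul_pow]
    gcongr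
    calc (1 - t / (x + α)) ^ (k + 2) ≤ Real.exp (-(t / (x + α))) ^ (k + 2) := by
          gcongr; exact Real.one_sub_le_exp_neg _
      _ = Real.exp (-((k + 2 : ℕ) * (t / (x + α)))) := by rw [← Real.exp_nat_mul]; congr 1; ring
      _ ≤ Real.exp (-(2 / 3 * (t / α))) := by
          rw [Real.exp_le_exp, neg_le_neg_iff]
          have h6 : t / (α * (k + 3)) ≤ t / (x + α) := by
            gcongr; linarith
          have h7 : 2 / 3 * (t / α) ≤ (k + 2 : ℕ) * (t / (α * (k + 3))) := by
            push_cast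
            rw [div_mul_div_comm, mul_div_assoc', div_le_div_iff₀ (by positivity) (by positivity)]
            have : 0 ≤ t * α * k := by positivity
            nlinarith
          refine h7.trans (by gcongr)
  have h8 : (1 + t / α) * Real.exp (-(2 / 3 * (t / α))) ≤ 6 * Real.exp (-(t / 2)) := by
    have hz : 0 < t / α := by positivity
    have h9 : 1 + t / α ≤ 6 * Real.exp (t / α / 6) := by linarith [Real.add_one_le_exp (t / α / 6)]
    have h10 : t ≤ t / α := by rw [le_div_iff₀ hα]; nlinarith
    calc (1 + t / α) * Real.exp (-(2 / 3 * (t / α)))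
        ≤ 6 * Real.exp (t / α / 6) * Real.exp (-(2 / 3 * (t / α))) := by gcongr
      _ = 6 * Real.exp (-(t / α / 2)) := by rw [mul_assoc, ← Real.exp_add]; congr 2; ring
      _ ≤ 6 * Real.exp (-(t / 2)) := by gcongr
  have h11 : 0 ≤ α * (k + 3) - x := by linarith
  have h12 : 0 ≤ x - t + α := by linarith
  unfold barrierSolution barrierMajorant
  calc 6 / α ^ 3 * ((α * (k + 2) - (x - t)) * (x - t + α) ^ (k + 2) / (k + 3).factorial)
      ≤ 6 / α ^ 3 * (((α * (k + 3) - x) * (1 + t / α)) *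
          ((x + α) ^ (k + 2) * Real.exp (-(2 / 3 * (t / α)))) / (k + 3).factorial) := by
        gcongr
    _ = 6 / α ^ 3 * ((α * (k + 3) - x) * (x + α) ^ (k + 2) / (k + 3).factorial) *
          ((1 + t / α) * Real.exp (-(2 / 3 * (t / α)))) := by ring
    _ ≤ 6 / α ^ 3 * ((α * (k + 3) - x) * (x + α) ^ (k + 2) / (k + 3).factorial) *
          (6 * Real.exp (-(t / 2))) := by gcongr
    _ = _ := by ring

/-- Induction through the second-moment recursion with $D=6\varepsilon$ times `barrierMajorant`; the
constant $108$ in `killedSolution` is $3\cdot6^2$. -/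
theorem HasExponentialSteps.killedSolution_le_minProb {μ : Measure (ℕ → WithTop ℝ)}
    [IsProbabilityMeasure μ] (hμ : HasExponentialSteps μ) {α ε : ℝ} (hα : 0 < α) (hα1 : α ≤ 1)
    (hε : 0 ≤ ε) (hε1 : ε ≤ 1) (k : ℕ) (x : ℝ) : killedSolution α ε k x ≤ minProb μ k x := by
  induction k generalizing x with
  | zero =>
    by_cases hx : x ∈ Ioo 0 α
    · rw [killedSolution, indicator_of_mem hx, minProb_zero, if_pos hx.1]
      exact hε1
    · rw [killedSolution, indicator_of_notMem hx]
      exact minProb_nonneg μ 0 x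
  | succ k ih =>
    by_cases hx : x ∈ Ioo 0 (α * (k + 2))
    · rw [killedSolution, indicator_of_mem hx]
      refine max_le (minProb_nonneg μ _ _) ?_
      have h := hμ.integral_sub_sq_le_minProb k (x := x)
        (D := ε * (6 * barrierMajorant α k x)) hx.1.le
        (measurable_killedSolution hα hε k) (killedSolution_nonneg hε k) ih ?_
      · refine le_trans (le_of_eq ?_) h
        ring
      · intro t ht
        by_cases hxt : x - t ∈ Ioo 0 (α * (k + 1))
        · refine (killedSolution_le hα hε hxt.1.le (by linarith [hx.2])).trans ?_
          rw [mul_assoc ε]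
          exact mul_le_mul_of_nonneg_left (barrierSolution_sub_le hα hα1 ht hxt.1.le hx.2.le) hε
        · rw [killedSolution_eq_zero hxt]
          have := barrierMajorant_nonneg hα hx.1.le (k := k) (by linarith [hx.2])
          positivity
    · rw [killedSolution, indicator_of_notMem hx]
      exact minProb_nonneg μ _ _

/-- Integration by parts in absolutely continuous form, because the killed solution is only
integrable and its primitive differentiable only almost everywhere. -/
lemma integral_mul_primitive {f F q : ℝ → ℝ} {b : ℝ} (hF : ContDiff ℝ 1 F)
    (hFf : ∀ t, HasDerivAt F (-f t) t) (hq : IntervalIntegrable q volume 0 b) :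
    ∫ t in (0 : ℝ)..b, f t * (∫ s in (0 : ℝ)..t, q s) =
      (∫ t in (0 : ℝ)..b, F t * q t) - F b * ∫ s in (0 : ℝ)..b, q s := by
  have hFac : AbsolutelyContinuousOnInterval F 0 b :=
    hF.contDiffOn.absolutelyContinuousOnInterval
  have hQac : AbsolutelyContinuousOnInterval (fun t => ∫ s in (0 : ℝ)..t, q s) 0 b :=
    hq.absolutelyContinuousOnInterval_intervalIntegral (c := 0) (by simp)
  have h := hFac.integral_mul_deriv_eq_deriv_mul hQac
  have h1 : ∫ t in (0 : ℝ)..b, F t * deriv (fun t => ∫ s in (0 : ℝ)..t, q s) t =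
      ∫ t in (0 : ℝ)..b, F t * q t := by
    refine intervalIntegral.integral_congr_ae ?_
    filter_upwards [hq.ae_hasDerivAt_integral] with t ht ht2
    rw [(ht (uIoc_subset_uIcc ht2) 0 (by simp)).deriv]
  have h2 : ∫ t in (0 : ℝ)..b, deriv F t * (∫ s in (0 : ℝ)..t, q s) =
      -∫ t in (0 : ℝ)..b, f t * (∫ s in (0 : ℝ)..t, q s) := by
    rw [← intervalIntegral.integral_neg]
    refine intervalIntegral.integral_congr fun t _ => ?_
    simp only [(hFf t).deriv]
    ring
  rw [h1, h2] at h
  simp only [intervalIntegral.integral_same, mul_zero, sub_zero] at h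
  linarith

/-- The pairing of the killed solution with the dual polynomial. -/
noncomputable def killedPairing (α ε : ℝ) (k i : ℕ) : ℝ :=
  ∫ t in (0 : ℝ)..(α * (k + 1)), abelPoly α i (α * (k + i + 1) - t) * killedSolution α ε k t

/-- The pairing of the quadratic error with the dual polynomial. -/
noncomputable def pairingLoss (α : ℝ) (k i : ℕ) : ℝ :=
  ∫ t in (0 : ℝ)..(α * (k + 2)), abelPoly α i (α * (k + i + 2) - t) * barrierMajorant α k t ^ 2

/-- Integration by parts moves one primitive from the solution to the polynomial, so the pairing
passes from $(k,i+1)$ to $(k+1,i)$. The boundary term has a good sign, the polynomial is nonnegative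
on the support, and replacing the maximum with $0$ by its second entry only lowers the integrand. -/
lemma killedPairing_succ_ge {α ε : ℝ} (hα : 0 < α) (hε : 0 ≤ ε) (k i : ℕ) :
    killedPairing α ε k (i + 1) - 108 * ε ^ 2 * pairingLoss α k i ≤
      killedPairing α ε (k + 1) i := by
  have hq := intervalIntegrable_killedSolution hα hε k
  have hb : (0 : ℝ) ≤ α * (k + 2) := by positivity
  set Q : ℝ → ℝ := fun t => ∫ s in (0 : ℝ)..t, killedSolution α ε k s with hQ
  have hQc : Continuous Q := intervalIntegral.continuous_primitive hq 0
  set f : ℝ → ℝ := fun t => abelPoly α i (α * (k + i + 2) - t) with hf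
  have hfc : Continuous f := (continuous_abelPoly α i).comp (by fun_prop)
  have hfnn : ∀ t, t ≤ α * (k + 2) → 0 ≤ f t := fun t ht =>
    abelPoly_nonneg hα (by linarith)
  have hGc := continuous_barrierMajorant α k
  have h1 : ∫ t in (0 : ℝ)..(α * (k + 2)), f t * (Q t - 108 * ε ^ 2 * barrierMajorant α k t ^ 2) ≤
      killedPairing α ε (k + 1) i := by
    unfold killedPairing
    have e1 : α * ((k + 1 : ℕ) + 1) = α * (k + 2) := by push_cast; ring
    have e2 : α * ((k + 1 : ℕ) + i + 1) = α * (k + i + 2) := by push_cast; ring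
    rw [e1, e2]
    refine intervalIntegral.integral_mono_on_of_le_Ioo hb
      (Continuous.intervalIntegrable (by fun_prop) _ _)
      ((intervalIntegrable_killedSolution hα hε (k + 1) _ _).continuousOn_mul hfc.continuousOn)
      fun t ht => ?_
    have h2 := hfnn t ht.2.le
    rw [killedSolution, indicator_of_mem ht]
    exact mul_le_mul_of_nonneg_left (le_max_right _ _) h2
  have h2 : ∫ t in (0 : ℝ)..(α * (k + 2)),
      f t * (Q t - 108 * ε ^ 2 * barrierMajorant α k t ^ 2) =
      (∫ t in (0 : ℝ)..(α * (k + 2)), f t * Q t) - 108 * ε ^ 2 * pairingLoss α k i := by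
    unfold pairingLoss
    rw [← intervalIntegral.integral_const_mul, ← intervalIntegral.integral_sub
      (Continuous.intervalIntegrable (by fun_prop) _ _)
      (Continuous.intervalIntegrable (by
        have : Continuous fun t => abelPoly α i (α * (k + i + 2) - t) := hfc
        fun_prop) _ _)]
    refine intervalIntegral.integral_congr fun t _ => ?_
    simp only [hf]
    ring
  set F : ℝ → ℝ := fun t => abelPoly α (i + 1) (α * (k + i + 2) - t) with hF
  have hFd : ∀ t, HasDerivAt F (-f t) t := by
    intro t
    have h3 : HasDerivAt (fun t : ℝ => α * (k + i + 2) - t) (-1) t :=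
      (hasDerivAt_id t).const_sub _
    refine ((hasDerivAt_abelPoly_succ α i _).comp t h3).congr_deriv ?_
    simp [hf]
  have hFc : ContDiff ℝ 1 F := by
    have : ContDiff ℝ 1 (abelPoly α (i + 1)) := by
      unfold abelPoly; fun_prop
    exact this.comp (by fun_prop)
  have h3 := integral_mul_primitive hFc hFd (hq 0 (α * (k + 2)))
  have h4 : F (α * (k + 2)) ≤ 0 := by
    have : α * (k + i + 2) - α * (k + 2) = α * i := by ring
    rw [hF]
    simp only [this]
    exact abelPoly_succ_barrier_nonpos hα i
  have h5 : 0 ≤ ∫ s in (0 : ℝ)..(α * (k + 2)), killedSolution α ε k s :=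
    intervalIntegral.integral_nonneg hb fun t _ => killedSolution_nonneg hε k t
  have h6 : ∫ t in (0 : ℝ)..(α * (k + 2)), F t * killedSolution α ε k t =
      killedPairing α ε k (i + 1) := by
    have hii : ∀ a b, IntervalIntegrable (fun t => F t * killedSolution α ε k t) volume a b :=
      fun a b => (hq a b).continuousOn_mul hFc.continuous.continuousOn
    rw [← intervalIntegral.integral_add_adjacent_intervals (hii 0 (α * (k + 1)))
      (hii (α * (k + 1)) (α * (k + 2)))]
    have h7 : ∫ t in (α * (k + 1))..(α * (k + 2)), F t * killedSolution α ε k t = 0 := by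
      rw [intervalIntegral.integral_congr (g := fun _ => (0 : ℝ)), intervalIntegral.integral_zero]
      intro t ht
      have hle : α * ((k : ℝ) + 1) ≤ α * (k + 2) := by gcongr; norm_num
      rw [uIcc_of_le hle] at ht
      simp only
      rw [killedSolution_eq_zero fun h => absurd h.2 (not_lt.2 ht.1), mul_zero]
    rw [h7, add_zero]
    unfold killedPairing
    have e2 : α * (k + (i + 1 : ℕ) + 1) = α * (k + i + 2) := by push_cast; ring
    rw [e2]
  have h8 : 0 ≤ -(F (α * (k + 2)) * ∫ s in (0 : ℝ)..(α * (k + 2)), killedSolution α ε k s) := by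
    rw [← neg_mul]; exact mul_nonneg (by linarith) h5
  linarith

lemma killedPairing_zero {α ε : ℝ} (hα : 0 < α) (M : ℕ) :
    killedPairing α ε 0 M = ε * (α * (α * M) ^ M / (M + 1).factorial) := by
  have h1 : killedPairing α ε 0 M = ∫ t in (0 : ℝ)..α, ε * abelPoly α M (α * (M + 1) - t) := by
    unfold killedPairing
    have e1 : α * ((0 : ℕ) + 1) = α := by simp
    rw [e1, intervalIntegral.integral_of_le hα.le, intervalIntegral.integral_of_le hα.le,
      ← setIntegral_congr_set Ioo_ae_eq_Ioc, ← setIntegral_congr_set Ioo_ae_eq_Ioc]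
    refine setIntegral_congr_fun measurableSet_Ioo fun t ht => ?_
    rw [killedSolution, indicator_of_mem ht, mul_comm]
    simp
  have h2 : ∀ t : ℝ, HasDerivAt (fun t => -abelPoly α (M + 1) (α * (M + 1) - t))
      (abelPoly α M (α * (M + 1) - t)) t := by
    intro t
    have h3 : HasDerivAt (fun t : ℝ => α * (M + 1) - t) (-1) t := (hasDerivAt_id t).const_sub _
    refine ((hasDerivAt_abelPoly_succ α M _).comp t h3).neg.congr_deriv ?_
    simp
  have hc : Continuous fun t => abelPoly α M (α * (M + 1) - t) :=
    (continuous_abelPoly α M).comp (by fun_prop)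
  rw [h1, intervalIntegral.integral_const_mul, intervalIntegral.integral_eq_sub_of_hasDerivAt
    (fun t _ => h2 t) (hc.intervalIntegrable _ _)]
  congr 1
  simp only [abelPoly]
  have e2 : α * ((M : ℝ) + 1) - α = α * M := by ring
  rw [e2]
  ring

/-- The pairing inequality is iterated along $k+i=M$, from the explicit value at $k=0$ to $k=M$,
where the polynomial is $1$ and the pairing is the integral defining the next generation. The
evaluation point $\alpha(M+1)$ lies just inside the barrier $\alpha(M+2)$ of generation `M + 1`. -/
theorem killedSolution_ge {α ε : ℝ} (hα : 0 < α) (hε : 0 ≤ ε) (M : ℕ) :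
    ε * (α * (α * M) ^ M / (M + 1).factorial) -
        108 * ε ^ 2 * (∑ k ∈ Finset.range M, pairingLoss α k (M - 1 - k)) -
        108 * ε ^ 2 * barrierMajorant α M (α * (M + 1)) ^ 2 ≤
      killedSolution α ε (M + 1) (α * (M + 1)) := by
  have key : ∀ k ≤ M, ε * (α * (α * M) ^ M / (M + 1).factorial) -
      108 * ε ^ 2 * (∑ j ∈ Finset.range k, pairingLoss α j (M - 1 - j)) ≤
        killedPairing α ε k (M - k) := by
    intro k
    induction k with
    | zero => intro _; simp [killedPairing_zero hα]
    | succ k ih =>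
      intro hk
      have h1 := ih (by omega)
      have h2 := killedPairing_succ_ge hα hε k (M - 1 - k)
      rw [show M - 1 - k + 1 = M - k by omega] at h2
      rw [Finset.sum_range_succ, show M - (k + 1) = M - 1 - k by omega]
      linarith
  have h1 := key M le_rfl
  have h2 : killedPairing α ε M (M - M) =
      ∫ t in (0 : ℝ)..(α * (M + 1)), killedSolution α ε M t := by
    unfold killedPairing
    rw [Nat.sub_self]
    simp [abelPoly]
  rw [h2] at h1
  have h3 : α * ((M : ℝ) + 1) ∈ Ioo 0 (α * (M + 2)) :=
    ⟨by positivity, by gcongr; norm_num⟩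
  rw [killedSolution, indicator_of_mem h3]
  refine le_trans ?_ (le_max_right _ _)
  linarith

end BRW

/-! ### Stirling estimates, the choice of slope and the summed loss. -/

namespace BRW

open Set Measure

lemma sqrt_mul_pow_le_factorial (n : ℕ) : √n * (n / Real.exp 1) ^ n ≤ n.factorial := by
  refine le_trans ?_ (Stirling.le_factorial_stirling n)
  gcongr
  nlinarith [Real.pi_gt_three, n.cast_nonneg (α := ℝ)]

lemma factorial_le_sqrt_mul_pow {n : ℕ} (hn : 1 ≤ n) :
    (n.factorial : ℝ) ≤ Real.exp 1 * (√n * (n / Real.exp 1) ^ n) := by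
  obtain ⟨m, rfl⟩ := Nat.exists_eq_add_of_le' hn
  have h := Stirling.stirlingSeq'_antitone (Nat.zero_le m)
  simp only [Function.comp, Nat.succ_eq_add_one, zero_add, Stirling.stirlingSeq_one] at h
  rw [Stirling.stirlingSeq, div_le_iff₀ (by positivity)] at h
  refine h.trans (le_of_eq ?_)
  rw [Real.sqrt_mul (by norm_num)]
  have : √(2 : ℝ) ≠ 0 := by positivity
  field_simp

/-- The power $3/2$ appears here: $1/2$ from Stirling's formula and $1$ from the missing factor `n +
1` in the numerator. -/
lemma pow_div_factorial_le (n : ℕ) :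
    ((n : ℝ) + 1) ^ n / (n + 1).factorial ≤ Real.exp 1 ^ (n + 1) / ((n + 1) * √(n + 1)) := by
  have h := sqrt_mul_pow_le_factorial (n + 1)
  push_cast at h
  rw [div_le_div_iff₀ (by positivity) (by positivity)]
  rw [div_pow] at h
  calc ((n : ℝ) + 1) ^ n * ((n + 1) * √(n + 1))
      = Real.exp 1 ^ (n + 1) * (√(n + 1) * ((n + 1) ^ (n + 1) / Real.exp 1 ^ (n + 1))) := by
        field_simp
        ring
    _ ≤ _ := by gcongr

/-- The order of magnitude of the value of the dual polynomials at the barrier. -/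
noncomputable def barrierWeight (α : ℝ) (k : ℕ) : ℝ :=
  (Real.exp 1 * α) ^ k / ((k + 1) * √(k + 1))

lemma barrierWeight_nonneg {α : ℝ} (hα : 0 < α) (k : ℕ) : 0 ≤ barrierWeight α k := by
  unfold barrierWeight; positivity

/-- In the variable `z`, the distance to the far end in units of `α`, the majorant is a weight
depending on `k` times $ze^{-z}$. Of $e^6$, four factors come from Stirling at `k + 4` and two from
the exponent `k + 2` in place of `k + 4`. -/
lemma barrierMajorant_le {α x : ℝ} (hα : 0 < α) (hx : 0 ≤ x) {k : ℕ} {z : ℝ}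
    (hz : α * (k + 3 - z) = x) (hz0 : 0 ≤ z) :
    barrierMajorant α k x ≤ 6 * Real.exp 6 * barrierWeight α k * (z * Real.exp (-z)) := by
  have hk : (0 : ℝ) ≤ k := k.cast_nonneg
  have hzk : z ≤ k + 3 := by
    by_contra h
    have : α * (k + 3 - z) < 0 := mul_neg_of_pos_of_neg hα (by linarith)
    linarith
  have e1 : x + α = α * ((k + 4) * (1 - z / (k + 4))) := by
    rw [← hz]; field_simp; ring
  have h1 : (1 - z / ((k : ℝ) + 4)) ^ (k + 2) ≤ Real.exp (2 - z) := by
    have h0 : 0 ≤ 1 - z / ((k : ℝ) + 4) := by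
      rw [sub_nonneg, div_le_one (by positivity)]; linarith
    calc (1 - z / ((k : ℝ) + 4)) ^ (k + 2) ≤ Real.exp (-(z / (k + 4))) ^ (k + 2) := by
          gcongr
          exact Real.one_sub_le_exp_neg _
      _ = Real.exp (-z + 2 * (z / (k + 4))) := by
          rw [← Real.exp_nat_mul]
          congr 1
          push_cast
          field_simp
          ring
      _ ≤ _ := by
          have : z / ((k : ℝ) + 4) ≤ 1 := by linarith
          gcongr
          linarith
  have h2 := pow_div_factorial_le (k + 3)
  push_cast at h2
  have e2 : (k : ℝ) + 3 + 1 = k + 4 := by ring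
  rw [e2] at h2
  have e3 : ((k + 3 + 1).factorial : ℝ) = (k + 4) * (k + 3).factorial := by
    rw [Nat.factorial_succ]; push_cast; ring
  rw [e3] at h2
  have h3 : Real.exp 1 ^ (k + 3 + 1) / (((k : ℝ) + 4) * √(k + 4)) ≤
      Real.exp 1 ^ (k + 3 + 1) / ((k + 1) * √(k + 1)) := by
    gcongr <;> norm_num
  have e4 : barrierMajorant α k x =
      6 * α ^ k * z * ((1 - z / (k + 4)) ^ (k + 2)) *
        ((k + 4) ^ (k + 3) / ((k + 4) * (k + 3).factorial)) := by
    unfold barrierMajorant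
    have e5 : α * (k + 3) - x = α * z := by rw [← hz]; ring
    rw [e1, e5, mul_pow, mul_pow]
    have : ((k + 3).factorial : ℝ) ≠ 0 := by positivity
    have : (k : ℝ) + 4 ≠ 0 := by positivity
    generalize (1 - z / ((k : ℝ) + 4)) ^ (k + 2) = y
    field_simp
    ring
  rw [e4]
  calc _ ≤ 6 * α ^ k * z * Real.exp (2 - z) *
        (Real.exp 1 ^ (k + 3 + 1) / ((k + 1) * √(k + 1))) := by
        exact mul_le_mul (mul_le_mul_of_nonneg_left h1 (by positivity)) (h2.trans h3)
          (by positivity) (by positivity)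
    _ = _ := by
        unfold barrierWeight
        rw [show 2 - z = 1 + 1 + -z by ring, Real.exp_add, Real.exp_add,
          show (6 : ℝ) = (6 : ℕ) * 1 by norm_num, Real.exp_nat_mul, mul_pow]
        push_cast
        ring

lemma abelPoly_le {α z : ℝ} (hα : 0 < α) (hz : 1 ≤ z) (i : ℕ) :
    abelPoly α i (α * (i + z - 1)) ≤ 3 * barrierWeight α i * (z * Real.exp z) := by
  cases i with
  | zero =>
    have h1 : 1 ≤ Real.exp z := Real.one_le_exp (by linarith)
    simp only [abelPoly, barrierWeight]
    norm_num
    nlinarith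
  | succ i =>
    have hi : (0 : ℝ) ≤ i := i.cast_nonneg
    have h1 := pow_div_factorial_le i
    have h2 : (1 + (z - 1) / ((i : ℝ) + 1)) ^ i ≤ Real.exp z := by
      have h0 : 0 ≤ (z - 1) / ((i : ℝ) + 1) := div_nonneg (by linarith) (by positivity)
      calc (1 + (z - 1) / ((i : ℝ) + 1)) ^ i ≤ Real.exp ((z - 1) / (i + 1)) ^ i := by
            gcongr
            rw [add_comm]
            exact Real.add_one_le_exp _
        _ = Real.exp (i / (i + 1) * (z - 1)) := by
            rw [← Real.exp_nat_mul]
            congr 1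
            ring
        _ ≤ _ := by
            have : (i : ℝ) / (i + 1) ≤ 1 := by
              rw [div_le_one (by positivity)]; linarith
            gcongr
            nlinarith
    have h3 : Real.exp 1 ^ (i + 1) / (((i : ℝ) + 1) * √(i + 1)) ≤
        3 * (Real.exp 1 ^ (i + 1) / ((i + 1 + 1) * √(i + 1 + 1))) := by
      rw [← mul_div_assoc, div_le_div_iff₀ (by positivity) (by positivity)]
      have h4 : √((i : ℝ) + 1 + 1) ≤ 3 / 2 * √(i + 1) := by
        refine Real.sqrt_le_iff.2 ⟨by positivity, ?_⟩
        rw [mul_pow, Real.sq_sqrt (by positivity)]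
        linarith
      calc Real.exp 1 ^ (i + 1) * (((i : ℝ) + 1 + 1) * √(i + 1 + 1))
          ≤ Real.exp 1 ^ (i + 1) * ((2 * (i + 1)) * (3 / 2 * √(i + 1))) := by
            gcongr
            linarith
        _ = _ := by ring
    have e1 : abelPoly α (i + 1) (α * ((i + 1 : ℕ) + z - 1)) =
        α ^ (i + 1) * (z - 1) * (1 + (z - 1) / (i + 1)) ^ i *
          ((i + 1) ^ i / (i + 1).factorial) := by
      have e2 : α * (((i + 1 : ℕ) : ℝ) + z - 1) = α * ((1 + (z - 1) / (i + 1)) * (i + 1)) := by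
        push_cast
        field_simp
        ring
      have e3 : α * (((i + 1 : ℕ) : ℝ) + z - 1) - α * (i + 1) = α * (z - 1) := by
        push_cast
        ring
      change (α * (((i + 1 : ℕ) : ℝ) + z - 1) - α * (i + 1)) *
        (α * (((i + 1 : ℕ) : ℝ) + z - 1)) ^ i / (i + 1).factorial = _
      rw [e3, e2, mul_pow, mul_pow]
      ring
    rw [e1]
    calc _ ≤ α ^ (i + 1) * z * Real.exp z *
          (3 * (Real.exp 1 ^ (i + 1) / ((i + 1 + 1) * √(i + 1 + 1)))) := by
          have h0 : 0 ≤ (z - 1) / ((i : ℝ) + 1) := div_nonneg (by linarith) (by positivity)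
          gcongr
          · linarith
          · exact h1.trans h3
      _ = _ := by
          unfold barrierWeight
          rw [mul_pow]
          push_cast
          ring

lemma pow_three_mul_exp_neg_le {z : ℝ} (hz : 0 ≤ z) :
    z ^ 3 * Real.exp (-z) ≤ 48 * Real.exp (-(z / 2)) := by
  have h := Real.pow_div_factorial_le_exp (z / 2) (by positivity) 3
  have e : Real.exp (-(z / 2)) = Real.exp (z / 2) * Real.exp (-z) := by
    rw [← Real.exp_add]; congr 1; ring
  rw [e, ← mul_assoc]
  gcongr
  norm_num [Nat.factorial] at h
  linarith

/-- In the same variable the polynomial grows like $ze^z$ and the squared majorant decays like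
$z^2e^{-2z}$. The product $z^3e^{-z}$ is integrable, so only the weights remain. -/
lemma pairingLoss_le {α : ℝ} (hα : 0 < α) (hα1 : α ≤ 1) (k i : ℕ) :
    pairingLoss α k i ≤ 10368 * Real.exp 12 * (barrierWeight α i * barrierWeight α k ^ 2) := by
  set W := barrierWeight α i * barrierWeight α k ^ 2 with hW
  have hW0 : 0 ≤ W := mul_nonneg (barrierWeight_nonneg hα i) (sq_nonneg _)
  set c := 5184 * Real.exp 12 * W with hc
  have hb : (0 : ℝ) ≤ α * (k + 2) := by positivity
  have hcont : Continuous fun t : ℝ => c * Real.exp (-((k + 3 - t / α) / 2)) := by fun_prop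
  have h1 : pairingLoss α k i ≤
      ∫ t in (0 : ℝ)..(α * (k + 2)), c * Real.exp (-((k + 3 - t / α) / 2)) := by
    unfold pairingLoss
    refine intervalIntegral.integral_mono_on hb (Continuous.intervalIntegrable ?_ _ _)
      (hcont.intervalIntegrable _ _) fun t ht => ?_
    · exact ((continuous_abelPoly α i).comp (by fun_prop)).mul
        ((continuous_barrierMajorant α k).pow 2)
    set z := (k : ℝ) + 3 - t / α with hz
    have ht2 : t / α ≤ k + 2 := by rw [div_le_iff₀ hα, mul_comm]; exact ht.2
    have hz1 : 1 ≤ z := by linarith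
    have e1 : α * (k + 3 - z) = t := by rw [hz]; field_simp; ring
    have e2 : α * (k + i + 2) - t = α * (i + z - 1) := by rw [← e1]; ring
    have hm := barrierMajorant_le hα ht.1 e1 (by linarith)
    have hm0 : 0 ≤ barrierMajorant α k t := barrierMajorant_nonneg hα ht.1 (by
      nlinarith [ht.2])
    have ha := abelPoly_le hα hz1 i
    rw [e2]
    have hwi := barrierWeight_nonneg hα i
    have hwk := barrierWeight_nonneg hα k
    calc abelPoly α i (α * (i + z - 1)) * barrierMajorant α k t ^ 2
        ≤ 3 * barrierWeight α i * (z * Real.exp z) *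
          (6 * Real.exp 6 * barrierWeight α k * (z * Real.exp (-z))) ^ 2 := by
          gcongr
      _ = 108 * Real.exp 12 * W * (z ^ 3 * Real.exp (-z)) := by
          have e3 : Real.exp 12 = Real.exp 6 * Real.exp 6 := by
            rw [← Real.exp_add]; norm_num
          have e4 : Real.exp z * Real.exp (-z) = 1 := by rw [← Real.exp_add]; simp
          rw [hW, e3]
          linear_combination (108 * Real.exp 6 * Real.exp 6 * barrierWeight α i *
            barrierWeight α k ^ 2 * z ^ 3 * Real.exp (-z)) * e4
      _ ≤ 108 * Real.exp 12 * W * (48 * Real.exp (-(z / 2))) := by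
          exact mul_le_mul_of_nonneg_left (pow_three_mul_exp_neg_le (by linarith))
            (by positivity)
      _ = c * Real.exp (-(z / 2)) := by rw [hc]; ring
  have hd : ∀ t : ℝ, HasDerivAt (fun t => c * (2 * α * Real.exp (-((k + 3 - t / α) / 2))))
      (c * Real.exp (-((k + 3 - t / α) / 2))) t := by
    intro t
    have h2 : HasDerivAt (fun t : ℝ => -((k + 3 - t / α) / 2)) (1 / α / 2) t := by
      refine (((((hasDerivAt_id t).div_const α).const_sub _).div_const 2).neg).congr_deriv ?_
      ring
    refine ((h2.exp.const_mul (2 * α)).const_mul c).congr_deriv ?_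
    field_simp
  rw [intervalIntegral.integral_eq_sub_of_hasDerivAt (fun t _ => hd t)
    (hcont.intervalIntegrable _ _)] at h1
  have hc0 : 0 ≤ c := by positivity
  have h3 : 0 ≤ c * (2 * α * Real.exp (-((k + 3 - 0 / α) / 2))) := by positivity
  have h4 : c * (2 * α * Real.exp (-((k + 3 - α * (k + 2) / α) / 2))) ≤ c * (2 * 1 * 1) := by
    gcongr
    rw [mul_div_cancel_left₀ _ hα.ne', Real.exp_le_one_iff]
    linarith
  calc pairingLoss α k i ≤ c * (2 * 1 * 1) := by linarith
    _ = _ := by rw [hc]; ring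

/-- The slope of the barrier that is used up to generation `n`. -/
noncomputable def barrierSlope (n : ℕ) : ℝ := Real.exp (3 / 2 * (Real.log n / n) - 1)

lemma barrierSlope_pos (n : ℕ) : 0 < barrierSlope n := Real.exp_pos _

lemma log_div_self_le (n : ℕ) : 3 / 2 * (Real.log n / n) ≤ 1 := by
  rcases Nat.eq_zero_or_pos n with rfl | hn
  · simp
  have hn0 : (0 : ℝ) < n := by exact_mod_cast hn
  have he : (2 : ℝ) < Real.exp 1 := by linarith [Real.exp_one_gt_d9]
  have h := Real.log_le_sub_one_of_pos (show 0 < (n : ℝ) / Real.exp 1 by positivity)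
  rw [Real.log_div hn0.ne' (Real.exp_ne_zero _), Real.log_exp] at h
  have h1 : Real.log n / n ≤ 1 / Real.exp 1 := by
    rw [div_le_iff₀ hn0, one_div, inv_mul_eq_div]; linarith
  have h2 : 1 / Real.exp 1 ≤ 1 / 2 := by gcongr
  linarith

lemma barrierSlope_le_one (n : ℕ) : barrierSlope n ≤ 1 := by
  rw [barrierSlope, Real.exp_le_one_iff]
  linarith [log_div_self_le n]

lemma exp_one_mul_barrierSlope (n : ℕ) :
    Real.exp 1 * barrierSlope n = Real.exp (3 / 2 * (Real.log n / n)) := by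
  rw [barrierSlope, ← Real.exp_add]; congr 1; ring

lemma mul_sqrt_eq_exp {x : ℝ} (hx : 0 < x) : x * √x = Real.exp (3 / 2 * Real.log x) := by
  rw [show 3 / 2 * Real.log x = Real.log x + Real.log x / 2 by ring, Real.exp_add,
    Real.exp_log hx, ← Real.log_sqrt hx.le, Real.exp_log (Real.sqrt_pos.2 hx)]

/-- The reason for the choice of slope: $(e\alpha)^n=n^{3/2}$ exactly offsets the polynomial decay
at generation `n`. -/
lemma exp_one_mul_barrierSlope_pow {n : ℕ} (hn : 1 ≤ n) :
    (Real.exp 1 * barrierSlope n) ^ n = n * √n := by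
  have hn0 : (0 : ℝ) < n := by exact_mod_cast hn
  rw [exp_one_mul_barrierSlope, ← Real.exp_nat_mul, mul_sqrt_eq_exp hn0]
  congr 1
  field_simp

lemma one_le_exp_one_mul_barrierSlope (n : ℕ) : 1 ≤ Real.exp 1 * barrierSlope n := by
  rw [exp_one_mul_barrierSlope]
  exact Real.one_le_exp (by have := Real.log_natCast_nonneg n; positivity)

/-- The claim is that $n^{3k/(2n)}$ is at most a constant times $(k+1)^{3/2}$. Splitting $\log n$ at
$\log(k+1)$, the excess is at most $\frac32\cdot\frac kn\log\frac n{k+1}\le\frac32$. -/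
lemma barrierWeight_slope_le {n k : ℕ} (hk : k ≤ n) :
    barrierWeight (barrierSlope n) k ≤ Real.exp 2 := by
  rcases Nat.eq_zero_or_pos n with rfl | hn
  · obtain rfl : k = 0 := by omega
    simp [barrierWeight]
  have hn0 : (0 : ℝ) < n := by exact_mod_cast hn
  have hk1 : (0 : ℝ) < k + 1 := by positivity
  have hkn : (k : ℝ) / n ≤ 1 := by rw [div_le_one hn0]; exact_mod_cast hk
  rw [barrierWeight, exp_one_mul_barrierSlope, ← Real.exp_nat_mul, mul_sqrt_eq_exp hk1,
    ← Real.exp_sub]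
  gcongr
  have h1 := Real.log_le_self (show 0 ≤ (n : ℝ) / (k + 1) by positivity)
  rw [Real.log_div hn0.ne' hk1.ne'] at h1
  have h2 : 0 ≤ Real.log ((k : ℝ) + 1) := Real.log_nonneg (by linarith [k.cast_nonneg (α := ℝ)])
  have h3 : (k : ℝ) / n * (n / (k + 1)) ≤ 1 := by
    rw [div_mul_div_cancel₀ hn0.ne', div_le_one hk1]; linarith
  have h4 : (k : ℝ) * (Real.log n / n) = k / n * (Real.log n - Real.log (k + 1)) +
      k / n * Real.log (k + 1) := by ring
  have h5 : (k : ℝ) / n * (Real.log n - Real.log (k + 1)) ≤ k / n * (n / (k + 1)) := by gcongr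
  have h6 : (k : ℝ) / n * Real.log (k + 1) ≤ 1 * Real.log (k + 1) := by gcongr
  nlinarith

lemma mul_sqrt_add_le {a b : ℝ} (ha : 0 ≤ a) (hb : 0 ≤ b) :
    (a + b) * √(a + b) ≤ 3 * (a * √a + b * √b) := by
  wlog hab : a ≤ b generalizing a b
  · rw [add_comm a b, add_comm (a * √a)]
    exact this hb ha (le_of_not_ge hab)
  have h1 : √(a + b) ≤ 3 / 2 * √b := by
    refine Real.sqrt_le_iff.2 ⟨by positivity, ?_⟩
    rw [mul_pow, Real.sq_sqrt hb]
    linarith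
  calc (a + b) * √(a + b) ≤ (2 * b) * (3 / 2 * √b) := by gcongr; linarith
    _ ≤ _ := by
      have := mul_nonneg ha (Real.sqrt_nonneg a)
      linarith

/-- One factor is bounded; the other two give at most $n^{3/2}/((k+1)(i+1))^{3/2}$. As
$n=(k+1)+(i+1)$, this is at most a multiple of $(k+1)^{-3/2}+(i+1)^{-3/2}$, so the loss concentrates
at the two ends and is summable. -/
lemma barrierWeight_slope_mul_sq_le {n k i : ℕ} (h : k + i + 2 = n) :
    barrierWeight (barrierSlope n) i * barrierWeight (barrierSlope n) k ^ 2 ≤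
      3 * Real.exp 2 * (1 / ((k + 1) * √(k + 1)) + 1 / ((i + 1) * √(i + 1))) := by
  set β := Real.exp 1 * barrierSlope n with hβ
  have hβ1 : 1 ≤ β := one_le_exp_one_mul_barrierSlope n
  have hwi := barrierWeight_nonneg (barrierSlope_pos n) i
  have hwk := barrierWeight_nonneg (barrierSlope_pos n) k
  have h1 : β ^ k * β ^ i ≤ n * √n := by
    rw [← exp_one_mul_barrierSlope_pow (show 1 ≤ n by omega), ← pow_add]
    exact pow_le_pow_right₀ hβ1 (by omega)
  have h2 : (n : ℝ) * √n ≤ 3 * ((k + 1) * √(k + 1) + (i + 1) * √(i + 1)) := by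
    have e : (n : ℝ) = (k + 1) + (i + 1) := by rw [← h]; push_cast; ring
    rw [e]
    exact mul_sqrt_add_le (by positivity) (by positivity)
  calc _ = barrierWeight (barrierSlope n) k *
        (barrierWeight (barrierSlope n) i * barrierWeight (barrierSlope n) k) := by ring
    _ ≤ Real.exp 2 *
        (barrierWeight (barrierSlope n) i * barrierWeight (barrierSlope n) k) := by
        gcongr
        exact barrierWeight_slope_le (by omega)
    _ = Real.exp 2 * (β ^ k * β ^ i / (((k + 1) * √(k + 1)) * ((i + 1) * √(i + 1)))) := by
        unfold barrierWeight
        rw [← hβ, div_mul_div_comm, mul_comm (β ^ i), mul_comm (((i : ℝ) + 1) * √(i + 1))]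
    _ ≤ Real.exp 2 * (3 * ((k + 1) * √(k + 1) + (i + 1) * √(i + 1)) /
        (((k + 1) * √(k + 1)) * ((i + 1) * √(i + 1)))) := by
        exact mul_le_mul_of_nonneg_left
          (div_le_div_of_nonneg_right (h1.trans h2) (by positivity)) (by positivity)
    _ = _ := by
        have hk : ((k : ℝ) + 1) * √(k + 1) ≠ 0 := by positivity
        have hi : ((i : ℝ) + 1) * √(i + 1) ≠ 0 := by positivity
        generalize ((k : ℝ) + 1) * √(k + 1) = a at *
        generalize ((i : ℝ) + 1) * √(i + 1) = b at *
        field_simp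
        ring

lemma exists_sum_one_div_mul_sqrt_le :
    ∃ S : ℝ, 0 ≤ S ∧ ∀ M : ℕ, ∑ k ∈ Finset.range M, 1 / (((k : ℝ) + 1) * √(k + 1)) ≤ S := by
  have hs : Summable fun k : ℕ => 1 / (((k : ℝ) + 1) * √(k + 1)) := by
    have h := (summable_nat_add_iff 1).2
      (Real.summable_one_div_nat_rpow.2 (show (1 : ℝ) < 3 / 2 by norm_num))
    refine h.congr fun k => ?_
    have hk : (0 : ℝ) < k + 1 := by positivity
    push_cast
    rw [mul_sqrt_eq_exp hk, Real.rpow_def_of_pos hk, mul_comm (Real.log _)]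
  exact ⟨_, tsum_nonneg fun k => by positivity, fun M =>
    hs.sum_le_tsum _ fun k _ => by positivity⟩

lemma exists_sum_pairingLoss_le :
    ∃ S : ℝ, 0 ≤ S ∧ ∀ M : ℕ,
      ∑ k ∈ Finset.range M, pairingLoss (barrierSlope (M + 1)) k (M - 1 - k) ≤ S := by
  obtain ⟨S, hS0, hS⟩ := exists_sum_one_div_mul_sqrt_le
  set c := 10368 * Real.exp 12 * (3 * Real.exp 2) with hc
  refine ⟨c * (S + S), by positivity, fun M => ?_⟩
  calc _ ≤ ∑ k ∈ Finset.range M, c * (1 / (((k : ℝ) + 1) * √(k + 1)) +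
        1 / ((((M - 1 - k : ℕ) : ℝ) + 1) * √((M - 1 - k : ℕ) + 1))) := by
        refine Finset.sum_le_sum fun k hk => ?_
        have hk := Finset.mem_range.1 hk
        refine (pairingLoss_le (barrierSlope_pos _) (barrierSlope_le_one _) _ _).trans ?_
        rw [hc, mul_assoc (10368 * Real.exp 12)]
        exact mul_le_mul_of_nonneg_left (barrierWeight_slope_mul_sq_le (by omega))
          (by positivity)
    _ = c * ((∑ k ∈ Finset.range M, 1 / (((k : ℝ) + 1) * √(k + 1))) +
        ∑ k ∈ Finset.range M, 1 / (((k : ℝ) + 1) * √(k + 1))) := by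
        rw [← Finset.mul_sum, Finset.sum_add_distrib,
          Finset.sum_range_reflect (fun k : ℕ => 1 / (((k : ℝ) + 1) * √(k + 1))) M]
    _ ≤ _ := by gcongr <;> exact hS M

/-- The main term does not decay: Stirling's upper bound costs one factor $e$, and replacing
$(M+1)^M$ by $M^M$ costs another. -/
lemma exp_neg_two_le_mul_pow_div_factorial (M : ℕ) :
    Real.exp (-2) ≤
      barrierSlope (M + 1) * (barrierSlope (M + 1) * M) ^ M / (M + 1).factorial := by
  set α := barrierSlope (M + 1) with hα
  have hα0 : 0 < α := barrierSlope_pos _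
  have h1 : ((M : ℝ) + 1) ^ M ≤ Real.exp 1 * M ^ M := by
    rcases Nat.eq_zero_or_pos M with rfl | hM
    · simp
    have hM0 : (0 : ℝ) < M := by exact_mod_cast hM
    have h2 : (1 + 1 / (M : ℝ)) ^ M ≤ Real.exp 1 := by
      calc (1 + 1 / (M : ℝ)) ^ M ≤ Real.exp (1 / M) ^ M := by
            gcongr
            rw [add_comm]
            exact Real.add_one_le_exp _
        _ = Real.exp 1 := by
            rw [← Real.exp_nat_mul]
            congr 1
            field_simp
    calc ((M : ℝ) + 1) ^ M = (1 + 1 / (M : ℝ)) ^ M * M ^ M := by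
          rw [← mul_pow]
          congr 1
          field_simp
      _ ≤ _ := by gcongr
  have h2 := factorial_le_sqrt_mul_pow (Nat.le_add_left 1 M)
  have h3 := exp_one_mul_barrierSlope_pow (Nat.le_add_left 1 M)
  rw [← hα] at h3
  push_cast at h2 h3
  rw [le_div_iff₀ (by positivity)]
  have he : Real.exp (-2) * (Real.exp 1 * Real.exp 1) = 1 := by
    rw [← Real.exp_add, ← Real.exp_add]; norm_num
  calc Real.exp (-2) * (M + 1).factorial
      ≤ Real.exp (-2) * (Real.exp 1 * (√(M + 1) * ((M + 1) / Real.exp 1) ^ (M + 1))) := by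
        gcongr
    _ = Real.exp (-2) * Real.exp 1 * ((M + 1) * √(M + 1) / Real.exp 1 ^ (M + 1)) *
        (M + 1) ^ M := by
        rw [div_pow]
        ring
    _ = Real.exp (-2) * Real.exp 1 * α ^ (M + 1) * (M + 1) ^ M := by
        rw [← h3, mul_pow, mul_div_cancel_left₀ _ (by positivity)]
    _ ≤ Real.exp (-2) * Real.exp 1 * α ^ (M + 1) * (Real.exp 1 * M ^ M) := by gcongr
    _ = Real.exp (-2) * (Real.exp 1 * Real.exp 1) * (α * (α * M) ^ M) := by
        rw [mul_pow]
        ring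
    _ = _ := by rw [he, one_mul]

lemma barrierMajorant_slope_le (M : ℕ) :
    barrierMajorant (barrierSlope (M + 1)) M (barrierSlope (M + 1) * (M + 1)) ≤
      12 * Real.exp 6 := by
  have hα0 := barrierSlope_pos (M + 1)
  have h := barrierMajorant_le (k := M) (z := 2) hα0
    (x := barrierSlope (M + 1) * (M + 1)) (by positivity) (by ring) (by norm_num)
  have h1 := barrierWeight_slope_le (Nat.le_add_right M 1)
  have he : Real.exp 2 * Real.exp (-2) = 1 := by rw [← Real.exp_add]; norm_num
  calc _ ≤ _ := h
    _ ≤ 6 * Real.exp 6 * Real.exp 2 * (2 * Real.exp (-2)) := by gcongr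
    _ = 12 * Real.exp 6 * (Real.exp 2 * Real.exp (-2)) := by ring
    _ = _ := by rw [he, mul_one]

/-- With probability bounded below, the minimum lies below the endpoint of the barrier. -/
theorem exists_le_minProb_barrierSlope :
    ∃ ε : ℝ, 0 < ε ∧ ε ≤ 1 ∧ ∀ (μ : Measure (ℕ → WithTop ℝ)) [IsProbabilityMeasure μ],
      HasExponentialSteps μ → ∀ n : ℕ, 1 ≤ n → ε ≤ minProb μ n (barrierSlope n * n) := by
  obtain ⟨S, hS0, hS⟩ := exists_sum_pairingLoss_le
  set c := Real.exp (-2) with hc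
  have hc0 : 0 < c := Real.exp_pos _
  have hc1 : c ≤ 1 := Real.exp_le_one_iff.2 (by norm_num)
  -- The main term is at least $\varepsilon c$ and the total loss at most $\varepsilon^2L$; the
  -- choice $\varepsilon=c/(2L)$ leaves $\varepsilon c/2$.
  set L := 108 * S + 108 * (12 * Real.exp 6) ^ 2 with hL
  have hL1 : 1 ≤ L := by
    have := Real.one_le_exp (show (0 : ℝ) ≤ 6 by norm_num)
    nlinarith
  set ε := c / (2 * L) with hε
  have hε0 : 0 < ε := by positivity
  have hε1 : ε ≤ 1 := by
    rw [hε, div_le_one (by positivity)]; linarith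
  have hεL : ε * L = c / 2 := by rw [hε]; field_simp
  refine ⟨ε * c / 2, by positivity, by nlinarith, fun μ _ hμ n hn => ?_⟩
  obtain ⟨M, rfl⟩ := Nat.exists_eq_add_of_le' hn
  have hα0 := barrierSlope_pos (M + 1)
  have h1 := killedSolution_ge hα0 hε0.le M
  have h2 := hμ.killedSolution_le_minProb hα0 (barrierSlope_le_one (M + 1)) hε0.le hε1 (M + 1)
    (barrierSlope (M + 1) * (M + 1))
  have h3 := barrierMajorant_slope_le M
  have h3' : 0 ≤ barrierMajorant (barrierSlope (M + 1)) M (barrierSlope (M + 1) * (M + 1)) :=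
    barrierMajorant_nonneg hα0 (by positivity) (by nlinarith)
  have h4 := mul_le_mul_of_nonneg_left (exp_neg_two_le_mul_pow_div_factorial M) hε0.le
  have h5 := mul_le_mul_of_nonneg_left (hS M) (show 0 ≤ 108 * ε ^ 2 by positivity)
  have h6 := mul_le_mul_of_nonneg_left (pow_le_pow_left₀ h3' h3 2)
    (show 0 ≤ 108 * ε ^ 2 by positivity)
  have h7 : 108 * ε ^ 2 * S + 108 * ε ^ 2 * (12 * Real.exp 6) ^ 2 = ε * (c / 2) := by
    rw [← hεL, hL]; ring
  push_cast at *
  linarith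

/-- Expanding $e^v\le1+v+v^2$ with $v=\frac{3\log n}{2n}$: the linear term gives $\frac{3}{2e}\log
n$, and $nv^2=\frac94(\log n)^2/n\le9$. -/
lemma barrierSlope_mul_le {n : ℕ} (hn : 1 ≤ n) :
    barrierSlope n * n ≤ n / Real.exp 1 + 3 / (2 * Real.exp 1) * Real.log n + 9 := by
  have hn0 : (0 : ℝ) < n := by exact_mod_cast hn
  have he : (1 : ℝ) ≤ Real.exp 1 := by linarith [Real.exp_one_gt_d9]
  have hlog : 0 ≤ Real.log n := Real.log_natCast_nonneg n
  set v := 3 / 2 * (Real.log n / n) with hv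
  have hv0 : 0 ≤ v := by positivity
  have h1 := (abs_le.1 (Real.abs_exp_sub_one_sub_id_le (x := v)
    (by rw [abs_of_nonneg hv0]; exact log_div_self_le n))).2
  have h2 : Real.log n ≤ 2 * √n := by
    have := Real.log_le_self (Real.sqrt_nonneg (n : ℝ))
    rw [Real.log_sqrt hn0.le] at this
    linarith
  have h3 : Real.log n ^ 2 ≤ 4 * n := by
    calc Real.log n ^ 2 ≤ (2 * √(n : ℝ)) ^ 2 := by gcongr
      _ = 4 * (n : ℝ) := by rw [mul_pow, Real.sq_sqrt hn0.le]; norm_num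
  have h4 : n * v ^ 2 ≤ 9 := by
    have : n * v ^ 2 = 9 / 4 * (Real.log n ^ 2 / n) := by rw [hv]; field_simp; ring
    rw [this]
    have : Real.log n ^ 2 / n ≤ 4 := by rw [div_le_iff₀ hn0]; exact h3
    linarith
  have e1 : barrierSlope n * n = n * Real.exp v / Real.exp 1 := by
    rw [hv, ← exp_one_mul_barrierSlope]; field_simp
  have e2 : (n : ℝ) / Real.exp 1 + 3 / (2 * Real.exp 1) * Real.log n =
      (n + n * v) / Real.exp 1 := by
    rw [hv]; field_simp
  rw [e1, e2]
  have h5 : n * Real.exp v ≤ n + n * v + 9 := by nlinarith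
  calc n * Real.exp v / Real.exp 1 ≤ (n + n * v + 9) / Real.exp 1 := by gcongr
    _ = (n + n * v) / Real.exp 1 + 9 / Real.exp 1 := by ring
    _ ≤ _ := by
      gcongr
      exact div_le_self (by norm_num) he

end BRW

/-! ### From distribution functions to the median. -/

namespace BRW

open Set Measure

theorem exists_half_le_minProb : ∃ C : ℝ, ∀ (μ : Measure (ℕ → WithTop ℝ))
    [IsProbabilityMeasure μ], HasExponentialSteps μ → ∀ n : ℕ, 1 ≤ n →
      1 / 2 ≤ minProb μ n (n / Real.exp 1 + 3 / (2 * Real.exp 1) * Real.log n + C) := by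
  obtain ⟨ε, hε, hε1, h⟩ := exists_le_minProb_barrierSlope
  obtain ⟨c, hc⟩ := half_le_minProb_succ_of_le hε hε1
  refine ⟨9 + c, fun μ _ hμ n hn => ?_⟩
  obtain ⟨k, rfl⟩ := Nat.exists_eq_add_of_le' hn
  set x := ((k + 1 : ℕ) : ℝ) / Real.exp 1 + 3 / (2 * Real.exp 1) * Real.log (k + 1 : ℕ) + 9
    with hx
  have h1 : ε ≤ minProb μ k x := by
    -- The extra generation is taken out of `n = k + 1`. The barrier estimate starts at generation
    -- $1$, so $k=0$ is done directly: $M_0=0$ lies below `x`.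
    rcases Nat.eq_zero_or_pos k with rfl | hk
    · rw [minProb_zero, if_pos]
      · exact hε1
      · have : 0 ≤ Real.log ((0 + 1 : ℕ) : ℝ) := Real.log_natCast_nonneg _
        positivity
    · refine (h μ hμ k hk).trans (minProb_mono μ k ((barrierSlope_mul_le hk).trans ?_))
      rw [hx]
      gcongr <;> simp
  rw [← add_assoc]
  exact hc μ hμ k x h1

/-- A distribution function that is below `1 / 2` at `a` and not at `b` has its median in
`[a, b]`. -/
lemma exists_median_eq_coe {Ω : Type*} [MeasurableSpace Ω] {P : Measure Ω} {M : Ω → EReal}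
    {a b : ℝ} (ha : P {ω | M ω < (a : EReal)} < 1 / 2)
    (hb : 1 / 2 ≤ P {ω | M ω < (b : EReal)}) :
    ∃ m : ℝ, median P M = m ∧ a ≤ m ∧ m ≤ b := by
  have h1 : (a : EReal) ≤ median P M := le_sSup ⟨a, ha, rfl⟩
  have h2 : median P M ≤ b := by
    refine sSup_le ?_
    rintro _ ⟨x, hx, rfl⟩
    rw [EReal.coe_le_coe_iff]
    by_contra! hbx
    refine absurd (hb.trans (measure_mono fun ω (hω : M ω < b) => ?_)) (not_le.2 hx)
    exact hω.trans (EReal.coe_lt_coe_iff.2 hbx)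
  have h3 : ((median P M).toReal : EReal) = median P M :=
    EReal.coe_toReal (h2.trans_lt (EReal.coe_lt_top b)).ne
      ((EReal.bot_lt_coe a).trans_le h1).ne'
  refine ⟨(median P M).toReal, h3.symm, ?_, ?_⟩
  · rwa [← EReal.coe_le_coe_iff, h3]
  · rwa [← EReal.coe_le_coe_iff, h3]

theorem exists_abs_median_sub_le : ∃ C : ℝ, ∀ (Ω : Type u) [MeasurableSpace Ω] (P : Measure Ω)
    [IsProbabilityMeasure P] (μ : Measure (ℕ → WithTop ℝ)) (X : List ℕ → Ω → ℕ → WithTop ℝ),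
    HasExponentialSteps μ → IsBranchingRandomWalk P μ X → ∀ n : ℕ, 1 ≤ n → ∃ m : ℝ,
      median P (minPosition X n) = (m : EReal) ∧
      |m - ((n : ℝ) / Real.exp 1 + 3 / (2 * Real.exp 1) * Real.log n)| ≤ C := by
  obtain ⟨C₁, h₁⟩ := exists_lt_half_of_recursion
  obtain ⟨C₂, h₂⟩ := exists_half_le_minProb
  refine ⟨max C₁ C₂, fun Ω _ P _ μ X hμ hX n hn => ?_⟩
  have := hX.isProbabilityMeasure
  have hhalf : ENNReal.ofReal (1 / 2) = 1 / 2 := by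
    rw [ENNReal.ofReal_div_of_pos two_pos]; simp
  have hlow := h₁ (minProb μ) (fun n _ => hμ.minProb_of_nonpos n) (minProb_le_one μ)
    (minProb_mono μ) (fun n _ => hμ.minProb_succ_le n) n hn
  have hup := h₂ μ hμ n hn
  obtain ⟨m, hm, hm1, hm2⟩ := exists_median_eq_coe (P := P) (M := minPosition X n)
    (a := n / Real.exp 1 + 3 / (2 * Real.exp 1) * Real.log n - C₁)
    (b := n / Real.exp 1 + 3 / (2 * Real.exp 1) * Real.log n + C₂)
    (by rw [hX.measure_minPosition_lt, ← ofReal_minProb, ← hhalf]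
        exact (ENNReal.ofReal_lt_ofReal_iff (by norm_num)).2 hlow)
    (by rw [hX.measure_minPosition_lt, ← ofReal_minProb, ← hhalf]
        exact ENNReal.ofReal_le_ofReal hup)
  refine ⟨m, hm, abs_le.2 ⟨?_, ?_⟩⟩
  · linarith [le_max_left C₁ C₂]
  · linarith [le_max_right C₁ C₂]

end BRW

theorem theorem1 :
    -- the median, with an error that is uniform over `n` and over all such walks
    (∃ C : ℝ, ∀ (Ω : Type u) [MeasurableSpace Ω] (P : Measure Ω) [IsProbabilityMeasure P]
      (μ : Measure (ℕ → WithTop ℝ)) (X : List ℕ → Ω → ℕ → WithTop ℝ),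
      BRW.HasExponentialSteps μ → BRW.IsBranchingRandomWalk P μ X →
      ∀ n : ℕ, 1 ≤ n → ∃ m : ℝ,
        BRW.median P (BRW.minPosition X n) = (m : EReal) ∧
        |m - ((n : ℝ) / Real.exp 1 + 3 / (2 * Real.exp 1) * Real.log n)| ≤ C) ∧
    -- the Poisson-weighted infinite tree has exponential steps
    (∀ (Ω : Type u) [MeasurableSpace Ω] (P : Measure Ω) [IsProbabilityMeasure P]
      (E : ℕ → Ω → ℝ), iIndepFun E P → (∀ i, HasLaw (E i) (expMeasure 1) P) →
      BRW.HasExponentialSteps (P.map (BRW.pwitDisplacement E))) ∧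
    -- the Poisson-Dirichlet branching random walk has exponential steps
    (∀ (Ω : Type u) [MeasurableSpace Ω] (P : Measure Ω) [IsProbabilityMeasure P]
      (U : ℕ → Ω → ℝ), iIndepFun U P →
      (∀ i, HasLaw (U i) (volume.restrict (Set.Icc (0 : ℝ) 1)) P) →
      BRW.HasExponentialSteps (P.map (BRW.pdDisplacement U))) :=
  ⟨BRW.exists_abs_median_sub_le,
    fun _ _ _ _ _ hE hlaw => BRW.hasExponentialSteps_pwit hE hlaw,
    fun _ _ _ _ _ hU hlaw => BRW.hasExponentialSteps_poissonDirichlet hU hlaw⟩
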